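/- Let $(M,g)$ be a smooth, connected, paracompact pseudo-Riemannian manifold of signature $(p,q)$ with $p-q\equiv 3$ or $7 \pmod 8$. Put $\alpha=-1$ if $p-q\equiv 3$ and $\alpha=+1$ if $p-q\equiv 7 \pmod 8$. Let $(V,h)$ be a real quadratic space of signature $(p,q)$. Clifford algebras are taken with $v^2=h(v,v)$; $\mathrm{Pin}$ consists of the elements of the Clifford group of twisted Clifford norm $\pm1$, and $\mathrm{Spin}$ of the even ones. Let $\mathrm{Cl}_2(\alpha)$ be generated by anticommuting $e_1,e_2$ with $e_1^2=e_2^2=\alpha$, let $\mathrm{Pin}_2(\alpha)$ be its pin group, with untwisted vector representation $\mathrm{Ad}^{(2)}_0$ on $\mathbb{R}^2$, and let $$\mathrm{Spin}^o(V,h)=\big(\mathrm{Spin}(V,h)\times \mathrm{Pin}_2(\alpha)\big)/\{\pm(1,1)\},\qquad \tilde\lambda([a,b])=\det(\mathrm{Ad}^{(2)}_0(b))\,\mathrm{Ad}_0(a)\in \mathrm{O}(V,h).$$ The group $\mathrm{Spin}(V,h)$ is regarded as the subgroup $\{[a,1]\}$ of $\mathrm{Spin}^o(V,h)$. Let $\gamma_0:\mathrm{Cl}(V,h)\to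 \mathrm{End}_{\mathbb R}(S_0)$ be an irreducible finite-dimensional real representation. Let $J=\gamma_0(\nu)$ for a Clifford volume element $\nu$ of $(V,h)$, and let $D\in\mathrm{End}_{\mathbb R}(S_0)$ satisfy $DJ=-JD$, $D\gamma_0(v)=-\gamma_0(v)D$ for all $v\in V$, and $D^2=\alpha$. Let $\gamma^{(2)}:\mathrm{Cl}_2(\alpha)\to \mathrm{End}_{\mathbb R}(S_0)$ be the representation with $e_1\mapsto D$, $e_2\mapsto -\alpha JD$, and put $\gamma_o([a,b])=\gamma_0(a)\gamma^{(2)}(b)$. Let $Q$ be a smooth principal $\mathrm{Spin}^o(V,h)$-bundle over $M$ with a smooth $\tilde\lambda$-equivariant map over $M$ to the bundle of orthonormal coframes of $(M,g)$. Let $(S,\gamma)$, with $\gamma:\mathrm{Cl}(T^*M,g^*)\to \mathrm{End}_{\mathbb R}(S)$, be a smooth bundle of irreducible real Clifford modules that is isomorphic, as a bundle of Clifford modules, to $Q\times_{\gamma_o}S_0$ with the Clifford multiplication $[z,v]\otimes[z,s]\mapsto[z,\gamma_0(v)s]$. Let $\Sigma,A\subset \mathrm{End}_{\mathbb R}(S)$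 be the bundles with fibers $$\Sigma_x=\{T : T\gamma_x(\xi)=\gamma_x(\xi)T\ \ \forall \xi\in T_x^*M\},\qquad A_x=\{T : T\gamma_x(\xi)=-\gamma_x(\xi)T\ \ \forall \xi\in T_x^*M\}$$ (the Schur bundle and the anticommutant bundle), and let $\Sigma\oplus A$ be the twist bundle. Then the following are equivalent: (a) the vector bundle $A$ is trivial; (b) the structure group of $S$ reduces from $\mathrm{Spin}^o(V,h)$ to $\mathrm{Spin}(V,h)$, i.e. there are a smooth principal $\mathrm{Spin}(V,h)$-bundle $Q'$ over $M$ and a smooth bundle map $Q'\to Q$ over $\mathrm{id}_M$ that is equivariant along $\mathrm{Spin}(V,h)\hookrightarrow\mathrm{Spin}^o(V,h)$. In this case $M$ is orientable, the Schur bundle $\Sigma$ is trivial (isomorphic to $M\times\mathbb{C}$ as a bundle of unital algebras), and the twist bundle $\Sigma\oplus A$ is trivial (isomorphic to $M\times\mathrm{Cl}_2(\alpha)$ as a bundle of unital algebras). -/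

import Mathlib

open Bundle Set Topology
open scoped Manifold ContDiff

noncomputable section

namespace SpinO

universe u v w

/-! ### Quadratic spaces, pin and spin groups -/

section Clifford

variable {V : Type*} [AddCommGroup V] [Module ℝ V]

/-- The quadratic form `h` on the finite-dimensional space `V` is nondegenerate of signature
`(p, q)`: `p` positive and `q` negative squares. -/
def HasSignature (h : QuadraticForm ℝ V) (p q : ℕ) : Prop :=
  sigPos h = p ∧ sigNeg h = q ∧ Module.finrank ℝ V = p + q

/-- The projection of the Clifford algebra onto the vectors; it inverts `ι : V → Cl(V, h)`. -/
def vectorPart (h : QuadraticForm ℝ V) : CliffordAlgebra h →ₗ[ℝ] V :=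
  ExteriorAlgebra.ιInv ∘ₗ (CliffordAlgebra.equivExterior h).toLinearMap

theorem vectorPart_ι (h : QuadraticForm ℝ V) (v : V) :
    vectorPart h (CliffordAlgebra.ι h v) = v := by
  have := ExteriorAlgebra.ι_leftInverse (R := ℝ) v
  simpa [vectorPart, CliffordAlgebra.equivExterior] using this

/-- `Pin(V, h)`: the elements of the Clifford group whose twisted Clifford norm `x̃ x` is `±1`,
where `x̃ = star x` is the twisted reversion.  (In the convention used here a vector `v` squares to
`h v`; Mathlib's `pinGroup` asks for norm `+1` and is too small for indefinite forms.) -/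
def Pin (h : QuadraticForm ℝ V) : Subgroup (CliffordAlgebra h)ˣ where
  carrier := {x | x ∈ lipschitzGroup h ∧
    (star (x : CliffordAlgebra h) * x = 1 ∨ star (x : CliffordAlgebra h) * x = -1)}
  one_mem' := ⟨one_mem _, Or.inl (by simp)⟩
  mul_mem' := by
    rintro x y ⟨hx, hx'⟩ ⟨hy, hy'⟩
    refine ⟨mul_mem hx hy, ?_⟩
    have key : star ((x * y : (CliffordAlgebra h)ˣ) : CliffordAlgebra h) * ((x * y : _) : _)
        = star (y : CliffordAlgebra h) * (star (x : CliffordAlgebra h) * x) * y := by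
      simp [mul_assoc]
    rw [key]
    rcases hx' with hx' | hx' <;> rcases hy' with hy' | hy' <;> simp [hx', hy']
  inv_mem' := by
    rintro x ⟨hx, hx'⟩
    refine ⟨inv_mem hx, ?_⟩
    have hmul : ((x⁻¹ : (CliffordAlgebra h)ˣ) : CliffordAlgebra h) * x = 1 := by simp
    have hmul' : (x : CliffordAlgebra h) * ((x⁻¹ : (CliffordAlgebra h)ˣ) : CliffordAlgebra h) = 1 :=
      by simp
    have hs : star ((x⁻¹ : (CliffordAlgebra h)ˣ) : CliffordAlgebra h) *
        star (x : CliffordAlgebra h) = 1 := by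
      rw [← star_mul, hmul', star_one]
    rcases hx' with hx' | hx'
    · left
      have h1 : star (x : CliffordAlgebra h) = ((x⁻¹ : (CliffordAlgebra h)ˣ) : CliffordAlgebra h) := by
        calc star (x : CliffordAlgebra h)
            = star (x : CliffordAlgebra h) * (x * (x⁻¹ : (CliffordAlgebra h)ˣ)) := by simp
          _ = _ := by rw [← mul_assoc, hx', one_mul]
      rw [← h1] at hs ⊢
      exact hs
    · right
      have h1 : star (x : CliffordAlgebra h)
          = -((x⁻¹ : (CliffordAlgebra h)ˣ) : CliffordAlgebra h) := by
        calc star (x : CliffordAlgebra h)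
            = star (x : CliffordAlgebra h) * (x * (x⁻¹ : (CliffordAlgebra h)ˣ)) := by simp
          _ = _ := by rw [← mul_assoc, hx', neg_one_mul]
      rw [h1, mul_neg] at hs
      rw [← hs, neg_neg]

/-- `Spin(V, h)`: the even elements of `Pin(V, h)`. -/
def Spin (h : QuadraticForm ℝ V) : Subgroup (CliffordAlgebra h)ˣ where
  carrier := {x | x ∈ Pin h ∧ (x : CliffordAlgebra h) ∈ CliffordAlgebra.even h}
  one_mem' := ⟨one_mem _, by simp⟩
  mul_mem' := fun hx hy => ⟨mul_mem hx.1 hy.1, by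
    simpa using mul_mem hx.2 hy.2⟩
  inv_mem' := by
    rintro x ⟨hx, hx'⟩
    refine ⟨inv_mem hx, ?_⟩
    have hstar : star (x : CliffordAlgebra h) ∈ CliffordAlgebra.even h := by
      rw [CliffordAlgebra.star_def]
      change _ ∈ CliffordAlgebra.evenOdd h 0
      rw [CliffordAlgebra.reverse_mem_evenOdd_iff, CliffordAlgebra.involute_mem_evenOdd_iff]
      exact hx'
    have h0 : star (x : CliffordAlgebra h)
        = star (x : CliffordAlgebra h) * x * (x⁻¹ : (CliffordAlgebra h)ˣ) := by simp [mul_assoc]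
    rcases hx.2 with h1 | h1
    · rw [h1, one_mul] at h0
      rwa [h0] at hstar
    · rw [h1, neg_one_mul] at h0
      rw [h0] at hstar
      simpa using neg_mem hstar

/-- The vector representation `v ↦ x v x⁻¹`. -/
def Ad₀ (h : QuadraticForm ℝ V) (x : (CliffordAlgebra h)ˣ) : V →ₗ[ℝ] V :=
  vectorPart h ∘ₗ LinearMap.mulRight ℝ ((x⁻¹ : (CliffordAlgebra h)ˣ) : CliffordAlgebra h) ∘ₗ
    LinearMap.mulLeft ℝ (x : CliffordAlgebra h) ∘ₗ CliffordAlgebra.ι h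

/-- On the Clifford group (in particular on `Pin` and `Spin`), `Ad₀` is conjugation. -/
theorem ι_Ad₀ (h : QuadraticForm ℝ V) {x : (CliffordAlgebra h)ˣ} (hx : x ∈ lipschitzGroup h)
    (v : V) : CliffordAlgebra.ι h (Ad₀ h x v)
      = x * CliffordAlgebra.ι h v * (x⁻¹ : (CliffordAlgebra h)ˣ) := by
  obtain ⟨w, hw⟩ := lipschitzGroup.conjAct_smul_ι_mem_range_ι hx v
  rw [ConjAct.units_smul_def, ConjAct.ofConjAct_toConjAct] at hw
  have : Ad₀ h x v = vectorPart h (x * CliffordAlgebra.ι h v * (x⁻¹ : (CliffordAlgebra h)ˣ)) := rfl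
  rw [this, ← hw, vectorPart_ι]

/-- The quadratic form `α (x² + y²)` on `ℝ²`. Its Clifford algebra is `Cl₂(α)`. -/
def planeForm (α : ℝ) : QuadraticForm ℝ (Fin 2 → ℝ) :=
  QuadraticMap.weightedSumSquares ℝ (fun _ : Fin 2 => α)

/-- The canonical generators `e₁ = planeGen α 0` and `e₂ = planeGen α 1` of `Cl₂(α)`. -/
def planeGen (α : ℝ) (i : Fin 2) : CliffordAlgebra (planeForm α) :=
  CliffordAlgebra.ι (planeForm α) (Pi.single i 1)

/-- The central subgroup `{(1, 1), (-1, -1)}` of `Spin(V, h) × Pin₂(α)`. -/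
def signSubgroup (h : QuadraticForm ℝ V) (α : ℝ) : Subgroup (Spin h × Pin (planeForm α)) where
  carrier := {x | ((x.1 : (CliffordAlgebra h)ˣ) = 1 ∧
      (x.2 : (CliffordAlgebra (planeForm α))ˣ) = 1) ∨
    ((x.1 : (CliffordAlgebra h)ˣ) = -1 ∧ (x.2 : (CliffordAlgebra (planeForm α))ˣ) = -1)}
  one_mem' := Or.inl ⟨rfl, rfl⟩
  mul_mem' := by
    rintro x y (⟨h1, h2⟩ | ⟨h1, h2⟩) (⟨h3, h4⟩ | ⟨h3, h4⟩)
    · exact Or.inl (by simp [-OneMemClass.coe_eq_one, h1, h2, h3, h4])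
    · exact Or.inr (by simp [-OneMemClass.coe_eq_one, h1, h2, h3, h4])
    · exact Or.inr (by simp [-OneMemClass.coe_eq_one, h1, h2, h3, h4])
    · exact Or.inl (by simp [-OneMemClass.coe_eq_one, h1, h2, h3, h4])
  inv_mem' := by
    rintro x (⟨h1, h2⟩ | ⟨h1, h2⟩)
    · exact Or.inl (by simp [-OneMemClass.coe_eq_one, h1, h2])
    · exact Or.inr (by simp [-OneMemClass.coe_eq_one, h1, h2])

instance (h : QuadraticForm ℝ V) (α : ℝ) : (signSubgroup h α).Normal where
  conj_mem := by
    rintro n (⟨h1, h2⟩ | ⟨h1, h2⟩) g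
    · left; simp [h1, h2]
    · right; simp [h1, h2]

/-- `Spinᵒ_α(V, h) = Spin(V, h) · Pin₂(α) = (Spin(V, h) × Pin₂(α)) / {±1}`. -/
abbrev SpinOGroup (h : QuadraticForm ℝ V) (α : ℝ) : Type _ :=
  (Spin h × Pin (planeForm α)) ⧸ signSubgroup h α

/-- The class `[a, b]`. -/
def SpinOGroup.mk (h : QuadraticForm ℝ V) (α : ℝ) (a : Spin h) (b : Pin (planeForm α)) :
    SpinOGroup h α :=
  QuotientGroup.mk (a, b)

/-- The inclusion `Spin(V, h) → Spinᵒ_α(V, h)`, `a ↦ [a, 1]`. -/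
def spinInclusion (h : QuadraticForm ℝ V) (α : ℝ) : Spin h →* SpinOGroup h α :=
  (QuotientGroup.mk' (signSubgroup h α)).comp (MonoidHom.inl _ _)

theorem Ad₀_neg_one_mul (h : QuadraticForm ℝ V) (x : (CliffordAlgebra h)ˣ) :
    Ad₀ h (x * (-1)) = Ad₀ h x := by
  ext v
  simp [Ad₀]

/-- The twisted vector representation `λ̃([a, b]) = det(Ad₀⁽²⁾(b)) Ad₀(a)`. -/
def twistedVectorRep (h : QuadraticForm ℝ V) (α : ℝ) : SpinOGroup h α → (V →ₗ[ℝ] V) :=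
  Quotient.lift
    (fun x : Spin h × Pin (planeForm α) =>
      LinearMap.det (Ad₀ (planeForm α) (x.2 : (CliffordAlgebra (planeForm α))ˣ)) •
        Ad₀ h (x.1 : (CliffordAlgebra h)ˣ)) (by
    intro x y hxy
    obtain ⟨n, rfl⟩ : ∃ n, y = x * n := ⟨x⁻¹ * y, by group⟩
    have hn : n ∈ signSubgroup h α := by
      have := QuotientGroup.leftRel_apply.1 hxy
      simpa using this
    rcases hn with ⟨h1, h2⟩ | ⟨h1, h2⟩
    · simp [h1, h2]
    · simp [h1, h2, Ad₀_neg_one_mul, -mul_neg, -mul_one])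

variable {S₀ : Type*} [NormedAddCommGroup S₀] [NormedSpace ℝ S₀]

/-- The twisted elementary representation `γₒ([a, b]) = γ₀(a) γ⁽²⁾(b)`. -/
def twistedRep (h : QuadraticForm ℝ V) (α : ℝ)
    (γ₀ : CliffordAlgebra h →ₐ[ℝ] (S₀ →L[ℝ] S₀))
    (γ₂ : CliffordAlgebra (planeForm α) →ₐ[ℝ] (S₀ →L[ℝ] S₀)) :
    SpinOGroup h α → (S₀ →L[ℝ] S₀) :=
  Quotient.lift
    (fun x : Spin h × Pin (planeForm α) =>
      γ₀ ((x.1 : (CliffordAlgebra h)ˣ) : CliffordAlgebra h) *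
        γ₂ ((x.2 : (CliffordAlgebra (planeForm α))ˣ) : CliffordAlgebra (planeForm α))) (by
    intro x y hxy
    obtain ⟨n, rfl⟩ : ∃ n, y = x * n := ⟨x⁻¹ * y, by group⟩
    have hn : n ∈ signSubgroup h α := by
      have := QuotientGroup.leftRel_apply.1 hxy
      simpa using this
    rcases hn with ⟨h1, h2⟩ | ⟨h1, h2⟩ <;> simp [h1, h2])

/-- `c` is a Clifford volume element of `(V, h)`: the ordered product of the vectors of an
orthonormal basis. -/
def IsVolumeElement (h : QuadraticForm ℝ V) (c : CliffordAlgebra h) : Prop :=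
  ∃ e : Module.Basis (Fin (Module.finrank ℝ V)) ℝ V,
    (∀ i, h (e i) = 1 ∨ h (e i) = -1) ∧
    (∀ i j, i ≠ j → QuadraticMap.polar h (e i) (e j) = 0) ∧
    c = (List.ofFn fun i => CliffordAlgebra.ι h (e i)).prod

/-- `γ₂` is `γ₀`-compatible: with `J = γ₀(ν)` for a Clifford volume element `ν` and some
`J`-antilinear `D` with `D γ₀(v) = -γ₀(v) D` for all vectors `v` and `D² = α`, it is the
representation of `Cl₂(α)` with `e₁ ↦ D`, `e₂ ↦ -α J D`. -/
def IsCompatible (h : QuadraticForm ℝ V) (α : ℝ)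
    (γ₀ : CliffordAlgebra h →ₐ[ℝ] (S₀ →L[ℝ] S₀))
    (γ₂ : CliffordAlgebra (planeForm α) →ₐ[ℝ] (S₀ →L[ℝ] S₀)) : Prop :=
  ∃ (c : CliffordAlgebra h) (D : S₀ →L[ℝ] S₀), IsVolumeElement h c ∧
    D * γ₀ c = -(γ₀ c * D) ∧
    (∀ v : V, D * γ₀ (CliffordAlgebra.ι h v) = -(γ₀ (CliffordAlgebra.ι h v) * D)) ∧
    D * D = α • (1 : S₀ →L[ℝ] S₀) ∧
    γ₂ (planeGen α 0) = D ∧ γ₂ (planeGen α 1) = -(α • (γ₀ c * D))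

end Clifford

/-- A representation of a Clifford algebra on `W` is elementary if it is irreducible over `ℝ`. -/
def IsElementary {V : Type*} [AddCommGroup V] [Module ℝ V] {h : QuadraticForm ℝ V}
    {W : Type*} [AddCommGroup W] [Module ℝ W] [TopologicalSpace W] [IsTopologicalAddGroup W]
    [ContinuousSMul ℝ W] (ρ : CliffordAlgebra h →ₐ[ℝ] (W →L[ℝ] W)) : Prop :=
  Nontrivial W ∧ ∀ N : Submodule ℝ W, (∀ c, ∀ x ∈ N, ρ c x ∈ N) → N = ⊥ ∨ N = ⊤

/-- The sign `α_{p,q}`: `-1` if `p - q ≡ 3` and `+1` if `p - q ≡ 7` modulo `8`. -/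
def alphaSign (p q : ℕ) : ℝ := if (p : ℤ) - q ≡ 3 [ZMOD 8] then -1 else 1

/-! ### Principal bundles -/

section Principal

/-- A smooth principal (right) `G`-bundle over `M`. The smooth structure of `G` enters through the
predicate `Sm f U`, "`f : M → G` is smooth on the open set `U`". The bundle is given by its fibres,
the simply transitive right action of `G` on them, and an atlas of local sections (pairs of an open
set `U` and a section, only meaningful on `U`) with smooth transition functions. -/
structure PrincipalBundle (M : Type u) [TopologicalSpace M] (G : Type v) [Group G]
    (Sm : (M → G) → Set M → Prop) where
  Fib : M → Type w
  act : ∀ {x : M}, Fib x → G → Fib x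
  act_one : ∀ {x : M} (q : Fib x), act q 1 = q
  act_mul : ∀ {x : M} (q : Fib x) (a b : G), act q (a * b) = act (act q a) b
  existsUnique_act : ∀ {x : M} (q q' : Fib x), ∃! a : G, act q a = q'
  atlas : Set (Set M × (∀ x, Fib x))
  isOpen_atlas : ∀ s ∈ atlas, IsOpen s.1
  cover : ∀ x : M, ∃ s ∈ atlas, x ∈ s.1
  smooth_transition : ∀ s ∈ atlas, ∀ t ∈ atlas, ∃ f : M → G,
    (∀ x ∈ s.1 ∩ t.1, t.2 x = act (s.2 x) (f x)) ∧ Sm f (s.1 ∩ t.1)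

variable {M : Type u} [TopologicalSpace M] {G H : Type*} [Group G] [Group H]
  {Sm : (M → G) → Set M → Prop}

/-- `σ` is a smooth section over the open set `U`. -/
def PrincipalBundle.IsSmoothSection (P : PrincipalBundle M G Sm) (U : Set M)
    (σ : ∀ x, P.Fib x) : Prop :=
  ∀ s ∈ P.atlas, ∃ f : M → G,
    (∀ x ∈ U ∩ s.1, σ x = P.act (s.2 x) (f x)) ∧ Sm f (U ∩ s.1)

/-- The structure group of `P` reduces along `j : H → G`: there are a principal `H`-bundle `P'`
over `M` and a smooth `j`-equivariant bundle map `P' → P` over the identity of `M`. -/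
def PrincipalBundle.ReducesAlong (P : PrincipalBundle.{u, _, w} M G Sm)
    (SmH : (M → H) → Set M → Prop) (j : H →* G) : Prop :=
  ∃ (P' : PrincipalBundle.{u, _, w} M H SmH) (F : ∀ x, P'.Fib x → P.Fib x),
    (∀ (x : M) (q : P'.Fib x) (a : H), F x (P'.act q a) = P.act (F x q) (j a)) ∧
    ∀ s ∈ P'.atlas, P.IsSmoothSection s.1 (fun x => F x (s.2 x))

end Principal

/-! ### Manifolds -/

section Manifold

variable (E : Type*) [NormedAddCommGroup E] [NormedSpace ℝ E]
  {M : Type u} [TopologicalSpace M] [ChartedSpace E M]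

/-- `f`, with values in a finite-dimensional real vector space, is smooth on the open set `U`:
all its coordinates are. -/
def SmoothVec {W : Type*} [AddCommGroup W] [Module ℝ W] (f : M → W) (U : Set M) : Prop :=
  ∀ l : Module.Dual ℝ W, ContMDiffOn 𝓘(ℝ, E) 𝓘(ℝ, ℝ) ∞ (fun x => l (f x)) U

section Groups

variable {V : Type*} [AddCommGroup V] [Module ℝ V] (h : QuadraticForm ℝ V) (α : ℝ)

/-- Smooth maps into `Pin(V, h)`, a closed submanifold of the vector space `Cl(V, h)`. -/
def SmoothPin (f : M → Pin h) (U : Set M) : Prop :=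
  SmoothVec E (fun x => ((f x : (CliffordAlgebra h)ˣ) : CliffordAlgebra h)) U

/-- Smooth maps into `Spin(V, h)`, a closed submanifold of the vector space `Cl(V, h)`. -/
def SmoothSpin (f : M → Spin h) (U : Set M) : Prop :=
  SmoothVec E (fun x => ((f x : (CliffordAlgebra h)ˣ) : CliffordAlgebra h)) U

/-- Smooth maps into `Spinᵒ_α(V, h)`, a quotient of `Spin(V, h) × Pin₂(α)` by a finite subgroup:
those that lift locally to smooth maps into the product. -/
def SmoothSpinO (f : M → SpinOGroup h α) (U : Set M) : Prop :=
  ∀ x ∈ U, ∃ (O : Set M) (a : M → Spin h) (b : M → Pin (planeForm α)),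
    IsOpen O ∧ x ∈ O ∧ SmoothSpin E h a (O ∩ U) ∧ SmoothPin E (planeForm α) b (O ∩ U) ∧
    ∀ y ∈ O ∩ U, f y = SpinOGroup.mk h α (a y) (b y)

end Groups

variable [IsManifold 𝓘(ℝ, E) ∞ M]

/-- `M` is orientable: its tangent spaces can be oriented in such a way that every point has a
neighbourhood with a smooth positively oriented frame. -/
def IsOrientable (M : Type u) [TopologicalSpace M] [ChartedSpace E M]
    [IsManifold 𝓘(ℝ, E) ∞ M] : Prop :=
  ∃ o : ∀ x : M, Orientation ℝ (TangentSpace 𝓘(ℝ, E) x) (Fin (Module.finrank ℝ E)),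
    ∀ x₀ : M, ∃ (U : Set M)
      (e : Fin (Module.finrank ℝ E) → ∀ x : M, TangentSpace 𝓘(ℝ, E) x)
      (he : IsLocalFrameOn 𝓘(ℝ, E) E ∞ e U), IsOpen U ∧ x₀ ∈ U ∧
      ∀ (x : M) (hx : x ∈ U), (he.toBasisAt hx).orientation = o x

/-- The cotangent space of `M` at `x`. -/
abbrev CotangentSpace (x : M) : Type _ :=
  TangentSpace 𝓘(ℝ, E) x →L[ℝ] Bundle.Trivial M ℝ x

/-- `ξ` is a smooth section of the cotangent bundle over the open set `U`. -/
def SmoothCovector (ξ : ∀ x : M, CotangentSpace E x) (U : Set M) : Prop :=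
  ContMDiffOn 𝓘(ℝ, E) (𝓘(ℝ, E).prod 𝓘(ℝ, E →L[ℝ] ℝ)) ∞
    (fun x => TotalSpace.mk' (E →L[ℝ] ℝ) (E := fun x : M => CotangentSpace E x) x (ξ x)) U

/-- A smooth pseudo-Riemannian metric of signature `(p, q)` on `M`. -/
structure PseudoRiemannianMetric (M : Type u) [TopologicalSpace M] [ChartedSpace E M]
    [IsManifold 𝓘(ℝ, E) ∞ M] (p q : ℕ) where
  form : ∀ x : M, TangentSpace 𝓘(ℝ, E) x →L[ℝ] TangentSpace 𝓘(ℝ, E) x →L[ℝ] ℝ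
  symm : ∀ (x : M) (a b : TangentSpace 𝓘(ℝ, E) x), form x a b = form x b a
  nondegenerate : ∀ (x : M) (a : TangentSpace 𝓘(ℝ, E) x), form x a = 0 → a = 0
  signature : ∀ x : M, HasSignature
    (LinearMap.BilinMap.toQuadraticMap
      (LinearMap.mk₂ ℝ (fun a b : TangentSpace 𝓘(ℝ, E) x => form x a b)
        (by simp) (by simp) (by simp) (by simp))) p q
  smooth : ContMDiff 𝓘(ℝ, E) (𝓘(ℝ, E).prod 𝓘(ℝ, E →L[ℝ] E →L[ℝ] ℝ)) ∞
    (fun x => TotalSpace.mk' (E →L[ℝ] E →L[ℝ] ℝ) x (form x))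

variable {E} [FiniteDimensional ℝ E] {p q : ℕ}

namespace PseudoRiemannianMetric

/-- The musical isomorphism `a ↦ g(a, ·)` from tangent to cotangent vectors. -/
def flat (g : PseudoRiemannianMetric E M p q) (x : M) :
    TangentSpace 𝓘(ℝ, E) x ≃ₗ[ℝ] CotangentSpace E x :=
  LinearEquiv.ofBijective ((g.form x).toLinearMap : TangentSpace 𝓘(ℝ, E) x →ₗ[ℝ]
    CotangentSpace E x) (by
    have hinj : Function.Injective ((g.form x).toLinearMap : TangentSpace 𝓘(ℝ, E) x →ₗ[ℝ]
        CotangentSpace E x) :=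
      (injective_iff_map_eq_zero _).2 (g.nondegenerate x)
    have e : Module.Dual ℝ E ≃ₗ[ℝ] (E →L[ℝ] ℝ) := LinearMap.toContinuousLinearMap
    have : FiniteDimensional ℝ (TangentSpace 𝓘(ℝ, E) x) :=
      inferInstanceAs (FiniteDimensional ℝ E)
    have : FiniteDimensional ℝ (CotangentSpace E x) :=
      inferInstanceAs (FiniteDimensional ℝ (E →L[ℝ] ℝ))
    have hdim : Module.finrank ℝ (TangentSpace 𝓘(ℝ, E) x)
        = Module.finrank ℝ (CotangentSpace E x) := by
      change Module.finrank ℝ E = Module.finrank ℝ (E →L[ℝ] ℝ)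
      rw [← e.finrank_eq]
      exact (Subspace.dual_finrank_eq (K := ℝ) (V := E)).symm
    exact ⟨hinj, (LinearMap.injective_iff_surjective_of_finrank_eq_finrank hdim).1 hinj⟩)

/-- The metric `g*` induced on the cotangent space, `g*(ξ, ξ) = ξ(ξ♯) = g(ξ♯, ξ♯)`. -/
def dualForm (g : PseudoRiemannianMetric E M p q) (x : M) :
    QuadraticForm ℝ (CotangentSpace E x) :=
  LinearMap.BilinMap.toQuadraticMap
    (LinearMap.mk₂ ℝ (fun ξ η : CotangentSpace E x => (ξ ((g.flat x).symm η) : ℝ))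
      (fun _ _ _ => rfl) (fun _ _ _ => rfl)
      (fun ξ a b => by rw [map_add, map_add]) (fun c ξ a => by rw [map_smul, map_smul]))

end PseudoRiemannianMetric

/-! ### Adapted structures and pinor bundles -/

variable {V : Type*} [AddCommGroup V] [Module ℝ V]

/-- A `Spinᵒ_α` structure on `(M, g)`: a principal `Spinᵒ_α(V, h)`-bundle `Q` with a smooth map
`Λ̃` over `M`, equivariant for the twisted vector representation, to the bundle of orthonormal
coframes, whose fibre at `x` consists of the isometries `(V, h) → (T*_x M, g*_x)`. -/
structure SpinOStructure (g : PseudoRiemannianMetric E M p q) (h : QuadraticForm ℝ V) (α : ℝ) where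
  Q : PrincipalBundle.{u, _, w} M (SpinOGroup h α) (SmoothSpinO E h α)
  Lam : ∀ x : M, Q.Fib x → h.IsometryEquiv (g.dualForm x)
  equivariant : ∀ (x : M) (z : Q.Fib x) (a : SpinOGroup h α) (v : V),
    Lam x (Q.act z a) v = Lam x z (twistedVectorRep h α a v)
  smooth : ∀ s ∈ Q.atlas, ∀ v : V, SmoothCovector E (fun x => Lam x (s.2 x) v) s.1

variable {S₀ : Type*} [NormedAddCommGroup S₀] [NormedSpace ℝ S₀]
  {S : M → Type*} [TopologicalSpace (TotalSpace S₀ S)]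
  [∀ x, AddCommGroup (S x)] [∀ x, Module ℝ (S x)] [∀ x, TopologicalSpace (S x)]
  [∀ x, IsTopologicalAddGroup (S x)] [∀ x, ContinuousSMul ℝ (S x)]
  [FiberBundle S₀ S] [VectorBundle ℝ S₀ S]

variable (E S₀) in
/-- `T` is a smooth section of the bundle `End(S)` over the open set `U`. -/
def SmoothEnd (T : ∀ x : M, S x →L[ℝ] S x) (U : Set M) : Prop :=
  ContMDiffOn 𝓘(ℝ, E) (𝓘(ℝ, E).prod 𝓘(ℝ, S₀ →L[ℝ] S₀)) ∞
    (fun x => TotalSpace.mk' (S₀ →L[ℝ] S₀) (E := fun x : M => S x →L[ℝ] S x) x (T x)) U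

variable (S₀ S) in
/-- The structure of an elementary real pinor bundle on the vector bundle `S`: a smooth morphism
`γ : Cl(T*M, g*) → End(S)` of bundles of unital algebras that is irreducible at every point. As
`Cl(T*M, g*)` is generated by `T*M`, smoothness of `γ` is smoothness of its restriction to `T*M`. -/
structure ElementaryPinor (g : PseudoRiemannianMetric E M p q) where
  γ : ∀ x : M, CliffordAlgebra (g.dualForm x) →ₐ[ℝ] (S x →L[ℝ] S x)
  elementary : ∀ x : M, IsElementary (γ x)
  smooth : ∀ (U : Set M) (ξ : ∀ x : M, CotangentSpace E x), IsOpen U → SmoothCovector E ξ U →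
    SmoothEnd E S₀ (fun x => γ x (CliffordAlgebra.ι (g.dualForm x) (ξ x))) U

/-- An isomorphism of bundles of Clifford modules between the bundle `Q ×_{γₒ} S₀` associated to
the `Spinᵒ` structure `(Q, Λ̃)` and the elementary pinor bundle `(S, γ)`. The class `[z, s]` goes
to `frame z s`; the Clifford multiplication of `Q ×_{γₒ} S₀` is `[z, v] ⊗ [z, s] ↦ [z, γ₀(v) s]`. -/
structure AssociatedIso {g : PseudoRiemannianMetric E M p q} {h : QuadraticForm ℝ V} {α : ℝ}
    (𝒬 : SpinOStructure.{u, w} g h α) (𝒮 : ElementaryPinor S₀ S g)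
    (γ₀ : CliffordAlgebra h →ₐ[ℝ] (S₀ →L[ℝ] S₀))
    (γ₂ : CliffordAlgebra (planeForm α) →ₐ[ℝ] (S₀ →L[ℝ] S₀)) where
  frame : ∀ x : M, 𝒬.Q.Fib x → (S₀ ≃L[ℝ] S x)
  equivariant : ∀ (x : M) (z : 𝒬.Q.Fib x) (a : SpinOGroup h α) (s : S₀),
    frame x (𝒬.Q.act z a) s = frame x z (twistedRep h α γ₀ γ₂ a s)
  clifford : ∀ (x : M) (z : 𝒬.Q.Fib x) (v : V) (s : S₀),
    𝒮.γ x (CliffordAlgebra.ι (g.dualForm x) (𝒬.Lam x z v)) (frame x z s)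
      = frame x z (γ₀ (CliffordAlgebra.ι h v) s)
  smooth : ∀ t ∈ 𝒬.Q.atlas, ∀ s : S₀,
    ContMDiffOn 𝓘(ℝ, E) (𝓘(ℝ, E).prod 𝓘(ℝ, S₀)) ∞
      (fun x => TotalSpace.mk' S₀ x (frame x (t.2 x) s)) t.1

/-! ### Natural sub-bundles of `End(S)` -/

/-- The fibre at `x` of the Schur bundle `Σ`. -/
def schurBundle {g : PseudoRiemannianMetric E M p q} (𝒮 : ElementaryPinor S₀ S g) (x : M) :
    Submodule ℝ (S x →L[ℝ] S x) where
  carrier := {T | ∀ ξ : CotangentSpace E x,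
    T * 𝒮.γ x (CliffordAlgebra.ι (g.dualForm x) ξ) = 𝒮.γ x (CliffordAlgebra.ι (g.dualForm x) ξ) * T}
  zero_mem' := by simp
  add_mem' := fun hA hB ξ => by rw [add_mul, mul_add, hA ξ, hB ξ]
  smul_mem' := fun c A hA ξ => by rw [smul_mul_assoc, mul_smul_comm, hA ξ]

/-- The fibre at `x` of the anticommutant bundle `A`. -/
def anticommutantBundle {g : PseudoRiemannianMetric E M p q} (𝒮 : ElementaryPinor S₀ S g) (x : M) :
    Submodule ℝ (S x →L[ℝ] S x) where
  carrier := {T | ∀ ξ : CotangentSpace E x, T * 𝒮.γ x (CliffordAlgebra.ι (g.dualForm x) ξ)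
    = -(𝒮.γ x (CliffordAlgebra.ι (g.dualForm x) ξ) * T)}
  zero_mem' := by simp
  add_mem' := fun hA hB ξ => by rw [add_mul, mul_add, hA ξ, hB ξ, neg_add]
  smul_mem' := fun c A hA ξ => by rw [smul_mul_assoc, mul_smul_comm, hA ξ, smul_neg]

/-- The fibre at `x` of the twist bundle `T = Σ ⊕ A`. -/
def twistBundle {g : PseudoRiemannianMetric E M p q} (𝒮 : ElementaryPinor S₀ S g) (x : M) :
    Submodule ℝ (S x →L[ℝ] S x) :=
  schurBundle 𝒮 x ⊔ anticommutantBundle 𝒮 x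

variable (E S₀) in
/-- The vector sub-bundle `B` of `End(S)` is trivial: it is isomorphic to a product `M × ℝⁿ` by a
smooth isomorphism of vector bundles. -/
def IsTrivialBundle (B : ∀ x : M, Submodule ℝ (S x →L[ℝ] S x)) : Prop :=
  ∃ (n : ℕ) (ψ : ∀ x : M, (Fin n → ℝ) ≃ₗ[ℝ] B x),
    ∀ c : Fin n → ℝ, SmoothEnd E S₀ (fun x => (ψ x c : S x →L[ℝ] S x)) univ

variable (E S₀) in
/-- The sub-bundle `B` of `End(S)` is trivial as a bundle of unital algebras of type `R`, for a
finite-dimensional algebra `R`: it is isomorphic to the product `M × R` by a smooth isomorphism of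
bundles of unital algebras. -/
def IsTrivialAlgBundle (R : Type*) [Ring R] [Algebra ℝ R]
    (B : ∀ x : M, Submodule ℝ (S x →L[ℝ] S x)) : Prop :=
  ∃ ψ : ∀ x : M, R →ₐ[ℝ] (S x →L[ℝ] S x),
    (∀ x, Function.Injective (ψ x) ∧ LinearMap.range (ψ x).toLinearMap = B x) ∧
    ∀ c : R, SmoothEnd E S₀ (fun x => ψ x c) univ

end Manifold

end SpinO

end

noncomputable section

namespace SpinO

universe u v w

/-! ### Clifford algebras and vector representations -/

section CliffordFacts

variable {V : Type*} [AddCommGroup V] [Module ℝ V]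

/-! Everything rests on the identification of the stabilizer of a frame of `A` under the structure
group. In the model, `dim V` is odd, so `J = γ₀(ν)` is central in the image of `γ₀`. The antilinear
map `D` prevents `J` from being a nonzero real scalar, and irreducibility then forces `J² = -1`. By
Schur's lemma the commutant of `γ₀` is `ℝ ⊕ ℝJ ≅ ℂ`. Multiplication by `D` exchanges commutant and
anticommutant, so the latter is `ℝD ⊕ ℝJD`. Hence `γ₂` embeds `Cl₂(α)` onto the sum of the two, with
the even part as commutant and the vectors as anticommutant (`IsCompatible.twistData`).

A point `z` of `Q` transports this picture to the fibre of `S` as an algebra map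
`AssociatedIso.twist`. Replacing `z` by `z·[a,b]` conjugates the argument by `b`, because the even
element `a` commutes with `γ₂` (`AssociatedIso.twist_act`). Thus `Spin` leaves the map unchanged.
Conversely, an element `[a,b]` that fixes both `e₁` and `e₂` has `b = ±1`, and `[a,-1] = [-a,1]`
lies in `Spin`.

Given a reduction `Q'`, the algebra map is therefore the same for all points of `Q'` over `x`. It
trivializes `A`, `Σ` and `Σ ⊕ A` globally. Since `dim V` is odd, `Ad₀` of `Spin` has determinant
one, so the coframes coming from `Q'` orient `M`.

Given a frame `(T₁, T₂)` of `A`, let `Q'` consist of the points `z` for which `(T₁, T₂)` is obtained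
from the images of `(e₁, e₂)` by an upper triangular matrix with positive diagonal. This is
Gram–Schmidt: an orthogonal matrix of that shape is the identity, so `Spin` acts simply transitively
on the fibres (`IsAdapted.exists_act_eq`). Local smooth adapted sections exist because the required
rotation lifts smoothly to `Pin₂(α)` by half-angle formulas, preceded by a flip `e₁` if the frame
has the wrong orientation (`exists_local_adapted`). -/

theorem finiteDimensional_exteriorAlgebra [FiniteDimensional ℝ V] :
    FiniteDimensional ℝ (ExteriorAlgebra ℝ V) := by
  have htop : (⨆ i : ℕ, ⋀[ℝ]^i V) = ⊤ :=
    (DirectSum.Decomposition.isInternal (fun i : ℕ => ⋀[ℝ]^i V)).submodule_iSup_eq_top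
  have hbot : ∀ i, Module.finrank ℝ V < i → ⋀[ℝ]^i V = ⊥ := fun i hi => by
    rw [← Submodule.finrank_eq_zero (R := ℝ), exteriorPower.finrank_eq, Nat.choose_eq_zero_of_lt hi]
  have hle : (⨆ i : ℕ, ⋀[ℝ]^i V) ≤ ⨆ i : Fin (Module.finrank ℝ V + 1), ⋀[ℝ]^(i : ℕ) V := by
    refine iSup_le fun i => ?_
    by_cases hi : Module.finrank ℝ V < i
    · rw [hbot i hi]; exact bot_le
    · exact le_iSup (fun i : Fin (Module.finrank ℝ V + 1) => ⋀[ℝ]^(i : ℕ) V) ⟨i, by omega⟩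
  rw [htop, top_le_iff] at hle
  have hfin : FiniteDimensional ℝ
      (⨆ i : Fin (Module.finrank ℝ V + 1), ⋀[ℝ]^(i : ℕ) V : Submodule ℝ (ExteriorAlgebra ℝ V)) :=
    Submodule.finiteDimensional_iSup _
  rw [hle] at hfin
  exact Module.Finite.equiv (Submodule.topEquiv (R := ℝ) (M := ExteriorAlgebra ℝ V))

instance finiteDimensional_cliffordAlgebra [FiniteDimensional ℝ V] (h : QuadraticForm ℝ V) :
    FiniteDimensional ℝ (CliffordAlgebra h) :=
  have := finiteDimensional_exteriorAlgebra (V := V)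
  Module.Finite.equiv (CliffordAlgebra.equivExterior h).symm

theorem ι_injective (h : QuadraticForm ℝ V) : Function.Injective (CliffordAlgebra.ι h) :=
  Function.LeftInverse.injective (vectorPart_ι h)

theorem Ad₀_one (h : QuadraticForm ℝ V) : Ad₀ h 1 = LinearMap.id := by
  ext v
  simp [Ad₀, vectorPart_ι]

theorem Ad₀_mul (h : QuadraticForm ℝ V) {x y : (CliffordAlgebra h)ˣ} (hx : x ∈ lipschitzGroup h)
    (hy : y ∈ lipschitzGroup h) : Ad₀ h (x * y) = Ad₀ h x ∘ₗ Ad₀ h y := by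
  ext v
  apply ι_injective h
  rw [LinearMap.comp_apply, ι_Ad₀ h (mul_mem hx hy), ι_Ad₀ h hx, ι_Ad₀ h hy]
  simp [mul_assoc]

/-- The unit of the Clifford algebra given by an anisotropic vector. -/
def vectorUnit (h : QuadraticForm ℝ V) (v : V) (hv : h v ≠ 0) : (CliffordAlgebra h)ˣ where
  val := CliffordAlgebra.ι h v
  inv := (h v)⁻¹ • CliffordAlgebra.ι h v
  val_inv := by
    rw [mul_smul_comm, CliffordAlgebra.ι_sq_scalar, Algebra.algebraMap_eq_smul_one, smul_smul,
      inv_mul_cancel₀ hv, one_smul]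
  inv_val := by
    rw [smul_mul_assoc, CliffordAlgebra.ι_sq_scalar, Algebra.algebraMap_eq_smul_one, smul_smul,
      inv_mul_cancel₀ hv, one_smul]

theorem vectorUnit_mem_lipschitzGroup (h : QuadraticForm ℝ V) (v : V) (hv : h v ≠ 0) :
    vectorUnit h v hv ∈ lipschitzGroup h :=
  Subgroup.subset_closure ⟨v, rfl⟩

/-- The factorization is `-1 = v⁻¹ · (-v)` for an anisotropic `v`. That `-1` lies in `Spin` is what
lets `[a,-1]` be rewritten as `[-a,1]`. -/
theorem neg_one_mem_lipschitzGroup (h : QuadraticForm ℝ V) (v : V) (hv : h v ≠ 0) :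
    (-1 : (CliffordAlgebra h)ˣ) ∈ lipschitzGroup h := by
  have hv' : h (-v) ≠ 0 := by rwa [QuadraticMap.map_neg]
  have : (-1 : (CliffordAlgebra h)ˣ) = (vectorUnit h v hv)⁻¹ * vectorUnit h (-v) hv' := by
    rw [eq_inv_mul_iff_mul_eq]
    ext
    simp [vectorUnit]
  rw [this]
  exact mul_mem (inv_mem (vectorUnit_mem_lipschitzGroup h v hv))
    (vectorUnit_mem_lipschitzGroup h (-v) hv')

theorem neg_one_mem_Spin (h : QuadraticForm ℝ V) (v : V) (hv : h v ≠ 0) :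
    (-1 : (CliffordAlgebra h)ˣ) ∈ Spin h :=
  ⟨⟨neg_one_mem_lipschitzGroup h v hv, Or.inl (by simp)⟩, by
    simp⟩

theorem ι_ne_zero_mul (h : QuadraticForm ℝ V) {v : V} (hv : IsUnit (CliffordAlgebra.ι h v)) :
    h v ≠ 0 := by
  intro h0
  have := hv.mul hv
  rw [CliffordAlgebra.ι_sq_scalar, h0, map_zero, isUnit_zero_iff] at this
  exact zero_ne_one this

/-- Untwisted conjugation by `v` is minus the reflection in `v⊥`. The reflection contributes `-1` to
the determinant and the scalar contributes `(-1)ⁿ`. -/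
theorem det_Ad₀_vectorUnit [FiniteDimensional ℝ V] (h : QuadraticForm ℝ V) (v : V) (hv : h v ≠ 0) :
    LinearMap.det (Ad₀ h (vectorUnit h v hv)) = (-1) ^ (Module.finrank ℝ V + 1) := by
  -- With this functional the reflection is `w ↦ w + f(w) v`, of determinant `1 + f(v) = 1 - 2`.
  set f : Module.Dual ℝ V := -((h v)⁻¹ • QuadraticMap.polarBilin h v)
  have hf : Ad₀ h (vectorUnit h v hv) = (-1 : ℝ) • LinearMap.transvection f v := by
    ext w
    apply ι_injective h
    rw [ι_Ad₀ h (vectorUnit_mem_lipschitzGroup h v hv)]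
    change CliffordAlgebra.ι h v * CliffordAlgebra.ι h w * ((h v)⁻¹ • CliffordAlgebra.ι h v) = _
    rw [mul_smul_comm, CliffordAlgebra.ι_mul_ι_mul_ι, ← map_smul]
    congr 1
    simp only [LinearMap.smul_apply, LinearMap.transvection.apply, f, LinearMap.neg_apply,
      QuadraticMap.polarBilin_apply_apply, smul_eq_mul, smul_sub, smul_smul, inv_mul_cancel₀ hv]
    module
  rw [hf, LinearMap.det_smul, LinearMap.transvection.det]
  have : f v = -2 := by
    simp [f, QuadraticMap.polar_self, mul_comm (2 : ℝ), ← mul_assoc, inv_mul_cancel₀ hv]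
  rw [this, pow_succ]
  norm_num

/-- The Clifford group is generated by invertible vectors, and in odd dimension each of them acts
with determinant `(-1)^(n+1) = 1`. -/
theorem det_Ad₀_of_odd [FiniteDimensional ℝ V] (h : QuadraticForm ℝ V)
    (hodd : Odd (Module.finrank ℝ V)) {x : (CliffordAlgebra h)ˣ} (hx : x ∈ lipschitzGroup h) :
    LinearMap.det (Ad₀ h x) = 1 := by
  have key : ∀ x y : (CliffordAlgebra h)ˣ, x ∈ lipschitzGroup h → y ∈ lipschitzGroup h →
      LinearMap.det (Ad₀ h (x * y)) = LinearMap.det (Ad₀ h x) * LinearMap.det (Ad₀ h y) :=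
    fun x y hx hy => by rw [Ad₀_mul h hx hy, LinearMap.det_comp]
  induction hx using Subgroup.closure_induction with
  | mem x hx =>
    obtain ⟨v, hv⟩ := hx
    have hv0 : h v ≠ 0 := ι_ne_zero_mul h (hv ▸ x.isUnit)
    have : x = vectorUnit h v hv0 := Units.ext hv.symm
    rw [this, det_Ad₀_vectorUnit, (hodd.add_one).neg_one_pow]
  | one => rw [Ad₀_one, LinearMap.det_id]
  | mul x y hx hy ihx ihy => rw [key x y hx hy, ihx, ihy, one_mul]
  | inv x hx ih =>
    have := key x x⁻¹ hx (inv_mem hx)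
    rw [mul_inv_cancel, Ad₀_one, LinearMap.det_id, ih, one_mul] at this
    exact this.symm

theorem list_prod_commute {A : Type*} [Ring A] [Algebra ℝ A] (x : A) (s : A → ℝ) (l : List A)
    (hl : ∀ y ∈ l, x * y = s y • (y * x)) : x * l.prod = (l.map s).prod • (l.prod * x) := by
  induction l with
  | nil => simp
  | cons y l ih =>
    rw [List.prod_cons, List.map_cons, List.prod_cons, ← mul_assoc, hl y (by simp), smul_mul_assoc,
      mul_assoc, ih fun z hz => hl z (by simp [hz]), mul_smul_comm, smul_smul, mul_assoc]

theorem list_prod_sq {A : Type*} [Ring A] (l : List A)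
    (hsq : ∀ y ∈ l, y * y = 1 ∨ y * y = -1) (hl : l.Pairwise fun x y => x * y = -(y * x)) :
    l.prod * l.prod = 1 ∨ l.prod * l.prod = -1 := by
  induction l with
  | nil => simp
  | cons y l ih =>
    rw [List.pairwise_cons] at hl
    have hcomm : ∀ l' : List A, (∀ z ∈ l', y * z = -(z * y)) →
        l'.prod * y = y * l'.prod ∨ l'.prod * y = -(y * l'.prod) := by
      intro l' hl'
      induction l' with
      | nil => simp
      | cons z l' ih' =>
        have hz := hl' z (by simp)
        rw [List.prod_cons, mul_assoc, ← mul_assoc y, hz]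
        rcases ih' fun w hw => hl' w (by simp [hw]) with h | h
        · right; rw [h]; simp [mul_assoc]
        · left; rw [h]; simp [mul_assoc]
    have h1 := ih (fun z hz => hsq z (by simp [hz])) hl.2
    have h2 := hsq y (by simp)
    have e : (y :: l).prod * (y :: l).prod = y * (l.prod * y) * l.prod := by
      simp [mul_assoc]
    rw [e]
    rcases hcomm l hl.1 with h | h
    · rw [h, ← mul_assoc y, mul_assoc]
      rcases h1 with h1 | h1 <;> rcases h2 with h2 | h2 <;> simp [h1, h2]
    · rw [h, mul_neg, ← mul_assoc y, neg_mul, mul_assoc]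
      rcases h1 with h1 | h1 <;> rcases h2 with h2 | h2 <;> simp [h1, h2]

theorem IsVolumeElement.sq {h : QuadraticForm ℝ V} {c : CliffordAlgebra h}
    (hc : IsVolumeElement h c) : c * c = 1 ∨ c * c = -1 := by
  obtain ⟨e, hsq, horth, rfl⟩ := hc
  apply list_prod_sq
  · intro y hy
    obtain ⟨i, rfl⟩ := List.mem_ofFn.1 hy
    rw [CliffordAlgebra.ι_sq_scalar]
    rcases hsq i with h | h <;> simp [h]
  · rw [List.pairwise_ofFn]
    intro i j hij
    have := CliffordAlgebra.ι_mul_ι_add_swap (Q := h) (e i) (e j)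
    rw [horth i j hij.ne, map_zero] at this
    exact eq_neg_of_add_eq_zero_left this

/-- Each basis vector commutes with its own factor of the volume element and anticommutes with the
remaining `n - 1`, an even number. -/
theorem IsVolumeElement.commute {h : QuadraticForm ℝ V} {c : CliffordAlgebra h}
    (hc : IsVolumeElement h c) (hodd : Odd (Module.finrank ℝ V)) (x : CliffordAlgebra h) :
    x * c = c * x := by
  obtain ⟨e, hsq, horth, rfl⟩ := hc
  have hvec : ∀ i, CliffordAlgebra.ι h (e i) * (List.ofFn fun i => CliffordAlgebra.ι h (e i)).prod
      = (List.ofFn fun i => CliffordAlgebra.ι h (e i)).prod * CliffordAlgebra.ι h (e i) := by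
    classical
    intro i
    have := list_prod_commute (CliffordAlgebra.ι h (e i))
      (fun y => if y = CliffordAlgebra.ι h (e i) then 1 else -1)
      (List.ofFn fun i => CliffordAlgebra.ι h (e i)) (by
        intro y hy
        obtain ⟨j, rfl⟩ := List.mem_ofFn.1 hy
        by_cases hij : j = i
        · simp [hij]
        · have hne : CliffordAlgebra.ι h (e j) ≠ CliffordAlgebra.ι h (e i) :=
            fun h' => hij (e.injective (ι_injective h h'))
          have := CliffordAlgebra.ι_mul_ι_add_swap (Q := h) (e i) (e j)
          rw [horth i j (Ne.symm hij), map_zero] at this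
          simp only [hne, if_false, neg_smul, one_smul]
          exact eq_neg_of_add_eq_zero_left this)
    rw [this, List.map_ofFn, List.prod_ofFn]
    have hprod : ∏ j, ((fun y => if y = CliffordAlgebra.ι h (e i) then (1 : ℝ) else -1) ∘
        fun i => CliffordAlgebra.ι h (e i)) j = 1 := by
      rw [← Finset.mul_prod_erase Finset.univ _ (Finset.mem_univ i)]
      have : ∀ j ∈ Finset.univ.erase i,
          ((fun y => if y = CliffordAlgebra.ι h (e i) then (1 : ℝ) else -1) ∘
            fun i => CliffordAlgebra.ι h (e i)) j = -1 := by
        intro j hj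
        have hne : CliffordAlgebra.ι h (e j) ≠ CliffordAlgebra.ι h (e i) :=
          fun h' => (Finset.ne_of_mem_erase hj) (e.injective (ι_injective h h'))
        simp [hne]
      rw [Finset.prod_congr rfl this, Finset.prod_const, Finset.card_erase_of_mem (Finset.mem_univ i),
        Finset.card_univ, Fintype.card_fin, Even.neg_one_pow]
      · simp
      · obtain ⟨k, hk⟩ := hodd
        exact ⟨k, by omega⟩
    rw [hprod, one_smul]
  induction x using CliffordAlgebra.induction with
  | algebraMap r => exact Algebra.commutes r _
  | ι v =>
    rw [← e.sum_repr v]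
    simp only [map_sum, map_smul, Finset.sum_mul, Finset.mul_sum, smul_mul_assoc, mul_smul_comm,
      hvec]
  | mul a b ha hb => rw [mul_assoc, hb, ← mul_assoc, ha, mul_assoc]
  | add a b ha hb => rw [add_mul, mul_add, ha, hb]

end CliffordFacts

/-! ### The plane Clifford algebra -/

section Plane

variable {α : ℝ}

theorem planeForm_apply (α : ℝ) (w : Fin 2 → ℝ) : planeForm α w = α * (w 0 * w 0 + w 1 * w 1) := by
  simp [planeForm, QuadraticMap.weightedSumSquares_apply, Fin.sum_univ_two, mul_add]

theorem planeGen_mul_self (α : ℝ) (i : Fin 2) : planeGen α i * planeGen α i = α • 1 := by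
  rw [planeGen, CliffordAlgebra.ι_sq_scalar, Algebra.algebraMap_eq_smul_one, planeForm_apply]
  fin_cases i <;> simp

theorem planeGen_anticomm (α : ℝ) :
    planeGen α 1 * planeGen α 0 = -(planeGen α 0 * planeGen α 1) := by
  have := CliffordAlgebra.ι_mul_ι_add_swap (Q := planeForm α) (Pi.single 1 1) (Pi.single 0 1)
  have h0 : QuadraticMap.polar (planeForm α) (Pi.single 1 1) (Pi.single 0 1) = 0 := by
    rw [QuadraticMap.polar, planeForm_apply, planeForm_apply, planeForm_apply]
    simp
    ring
  rw [h0, map_zero] at this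
  exact eq_neg_of_add_eq_zero_left this

theorem ι_planeForm (α : ℝ) (w : Fin 2 → ℝ) :
    CliffordAlgebra.ι (planeForm α) w = w 0 • planeGen α 0 + w 1 • planeGen α 1 := by
  rw [planeGen, planeGen, ← map_smul, ← map_smul, ← map_add]
  congr 1
  ext i
  fin_cases i <;> simp

/-- The element `a + b e₁ + c e₂ + d e₁e₂` of `Cl₂(α)`. -/
def planeElt (α a b c d : ℝ) : CliffordAlgebra (planeForm α) :=
  a • 1 + b • planeGen α 0 + c • planeGen α 1 + d • (planeGen α 0 * planeGen α 1)

/-- This multiplication table reduces the identities in `Cl₂(α)` to polynomial identities between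
real coefficients. -/
theorem planeElt_mul (α a b c d a' b' c' d' : ℝ) :
    planeElt α a b c d * planeElt α a' b' c' d' =
      planeElt α (a * a' + α * (b * b') + α * (c * c') - α ^ 2 * (d * d'))
        (a * b' + b * a' - α * (c * d') + α * (d * c'))
        (a * c' + c * a' + α * (b * d') - α * (d * b'))
        (a * d' + d * a' + b * c' - c * b') := by
  have h11 := planeGen_mul_self α 0
  have h22 := planeGen_mul_self α 1
  have h21 := planeGen_anticomm α
  have h112 : planeGen α 0 * (planeGen α 0 * planeGen α 1) = α • planeGen α 1 := by
    rw [← mul_assoc, h11, smul_mul_assoc, one_mul]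
  have h212 : planeGen α 1 * (planeGen α 0 * planeGen α 1) = -(α • planeGen α 0) := by
    rw [← mul_assoc, h21, neg_mul, mul_assoc, h22, mul_smul_comm, mul_one]
  have h121 : planeGen α 0 * planeGen α 1 * planeGen α 0 = -(α • planeGen α 1) := by
    rw [mul_assoc, h21, mul_neg, h112]
  have h122 : planeGen α 0 * planeGen α 1 * planeGen α 1 = α • planeGen α 0 := by
    rw [mul_assoc, h22, mul_smul_comm, mul_one]
  have h1212 : planeGen α 0 * planeGen α 1 * (planeGen α 0 * planeGen α 1) = -((α ^ 2) • 1) := by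
    rw [← mul_assoc, h121, neg_mul, smul_mul_assoc, h22, smul_smul, sq]
  simp only [planeElt, add_mul, mul_add, smul_mul_smul_comm, one_mul, mul_one, h11, h22, h21, h112,
    h212, h121, h122, h1212]
  module

theorem exists_eq_planeElt (x : CliffordAlgebra (planeForm α)) :
    ∃ a b c d, x = planeElt α a b c d := by
  induction x using CliffordAlgebra.induction with
  | algebraMap r => exact ⟨r, 0, 0, 0, by simp [planeElt, Algebra.algebraMap_eq_smul_one]⟩
  | ι w => exact ⟨0, w 0, w 1, 0, by simp [planeElt, ι_planeForm]⟩
  | mul x y hx hy =>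
    obtain ⟨a, b, c, d, rfl⟩ := hx
    obtain ⟨a', b', c', d', rfl⟩ := hy
    exact ⟨_, _, _, _, planeElt_mul ..⟩
  | add x y hx hy =>
    obtain ⟨a, b, c, d, rfl⟩ := hx
    obtain ⟨a', b', c', d', rfl⟩ := hy
    exact ⟨a + a', b + b', c + c', d + d', by simp only [planeElt]; module⟩

theorem ι_eq_planeElt (α : ℝ) (w : Fin 2 → ℝ) :
    CliffordAlgebra.ι (planeForm α) w = planeElt α 0 (w 0) (w 1) 0 := by
  simp [planeElt, ι_planeForm]

theorem planeGen_zero_eq (α : ℝ) : planeGen α 0 = planeElt α 0 1 0 0 := by simp [planeElt]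

theorem planeGen_one_eq (α : ℝ) : planeGen α 1 = planeElt α 0 0 1 0 := by simp [planeElt]

theorem planeElt_one (α : ℝ) : planeElt α 1 0 0 0 = 1 := by simp [planeElt]

theorem star_planeGen (α : ℝ) (i : Fin 2) : star (planeGen α i) = -planeGen α i := by
  simp [planeGen]

theorem star_planeElt (α a b c d : ℝ) :
    star (planeElt α a b c d) = planeElt α a (-b) (-c) (-d) := by
  simp only [planeElt, star_add, CliffordAlgebra.star_smul, star_mul, star_planeGen, star_one,
    neg_mul_neg, planeGen_anticomm]
  module

theorem smul_one_inj {h : QuadraticForm ℝ (Fin 2 → ℝ)} {r s : ℝ}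
    (hrs : r • (1 : CliffordAlgebra h) = s • 1) : r = s :=
  smul_left_injective ℝ (one_ne_zero (α := CliffordAlgebra h)) hrs

theorem planeGen_zero_mem_Pin (hα : α = 1 ∨ α = -1) :
    ∃ b : Pin (planeForm α), ((b : (CliffordAlgebra (planeForm α))ˣ) :
      CliffordAlgebra (planeForm α)) = planeGen α 0 := by
  have h0 : planeForm α (Pi.single 0 1) ≠ 0 := by
    rw [planeForm_apply]; rcases hα with rfl | rfl <;> simp
  refine ⟨⟨vectorUnit _ _ h0, vectorUnit_mem_lipschitzGroup _ _ h0, ?_⟩, rfl⟩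
  change star (planeGen α 0) * planeGen α 0 = 1 ∨ star (planeGen α 0) * planeGen α 0 = -1
  rw [star_planeGen, neg_mul, planeGen_mul_self]
  rcases hα with rfl | rfl <;> simp

/-- The rotation spinor `X - α Y e₁e₂` lies in `Pin₂(α)`. -/
theorem rotationSpinor_mem_Pin (hα : α = 1 ∨ α = -1) {X Y : ℝ} (hXY : X ^ 2 + Y ^ 2 = 1) :
    ∃ b : Pin (planeForm α), ((b : (CliffordAlgebra (planeForm α))ˣ) :
      CliffordAlgebra (planeForm α)) = planeElt α X 0 0 (-(α * Y)) := by
  have h0 : planeForm α (Pi.single 0 1) ≠ 0 := by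
    rw [planeForm_apply]; rcases hα with rfl | rfl <;> simp
  have hα2 : α ^ 2 = 1 := by rcases hα with rfl | rfl <;> norm_num
  -- The spinor factors into two vectors: `X - αY e₁e₂ = e₁ · (αX e₁ - αY e₂)`.
  have h1 : planeForm α ![α * X, -(α * Y)] ≠ 0 := by
    rw [planeForm_apply]
    simp only [Matrix.cons_val_zero, Matrix.cons_val_one]
    have : α * (α * X * (α * X) + -(α * Y) * -(α * Y)) = α := by
      linear_combination (α * X ^ 2 + α * Y ^ 2) * hα2 + α * hXY
    rw [this]; rcases hα with rfl | rfl <;> simp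
  have hval : ((vectorUnit _ _ h0 * vectorUnit _ _ h1 : (CliffordAlgebra (planeForm α))ˣ) :
      CliffordAlgebra (planeForm α)) = planeElt α X 0 0 (-(α * Y)) := by
    change CliffordAlgebra.ι _ _ * CliffordAlgebra.ι _ _ = _
    rw [ι_eq_planeElt, ι_eq_planeElt, planeElt_mul]
    congr 1 <;> simp
    rw [← mul_assoc, ← sq, hα2, one_mul]
  refine ⟨⟨vectorUnit _ _ h0 * vectorUnit _ _ h1,
    mul_mem (vectorUnit_mem_lipschitzGroup _ _ h0) (vectorUnit_mem_lipschitzGroup _ _ h1),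
    Or.inl ?_⟩, hval⟩
  rw [hval, star_planeElt, planeElt_mul, ← planeElt_one]
  congr 1 <;> ring_nf
  linear_combination hXY + (α ^ 2 + 1) * Y ^ 2 * hα2

theorem eq_one_or_neg_one_of_commute (hα : α = 1 ∨ α = -1) (b : Pin (planeForm α))
    (h0 : (b : (CliffordAlgebra (planeForm α))ˣ) * planeGen α 0
      = planeGen α 0 * (b : (CliffordAlgebra (planeForm α))ˣ))
    (h1 : (b : (CliffordAlgebra (planeForm α))ˣ) * planeGen α 1
      = planeGen α 1 * (b : (CliffordAlgebra (planeForm α))ˣ)) :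
    (b : (CliffordAlgebra (planeForm α))ˣ) = 1 ∨ (b : (CliffordAlgebra (planeForm α))ˣ) = -1 := by
  have hα2 : α ^ 2 = 1 := by rcases hα with rfl | rfl <;> norm_num
  set x : CliffordAlgebra (planeForm α) := ((b : (CliffordAlgebra (planeForm α))ˣ) :
    CliffordAlgebra (planeForm α)) with hx
  obtain ⟨s, t, u, v, hstuv⟩ := exists_eq_planeElt x
  -- As `eᵢ⁻¹ = α eᵢ`, these are conjugations that fix `x`. Averaging `x` over the conjugations by
  -- `1, e₁, e₂, e₁e₂` kills every component except the scalar one.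
  have e0 : α • (planeGen α 0 * x * planeGen α 0) = x := by
    rw [mul_assoc, h0, ← mul_assoc, planeGen_mul_self, smul_mul_assoc, one_mul, smul_smul, ← sq,
      hα2, one_smul]
  have e1 : α • (planeGen α 1 * x * planeGen α 1) = x := by
    rw [mul_assoc, h1, ← mul_assoc, planeGen_mul_self, smul_mul_assoc, one_mul, smul_smul, ← sq,
      hα2, one_smul]
  have e2 : α • (planeGen α 1 * (α • (planeGen α 0 * x * planeGen α 0)) * planeGen α 1) = x := by
    rw [e0, e1]
  have hxs : x = s • 1 := by
    have h4 : (4 : ℝ) • x = x + α • (planeGen α 0 * x * planeGen α 0)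
        + α • (planeGen α 1 * x * planeGen α 1)
        + α • (planeGen α 1 * (α • (planeGen α 0 * x * planeGen α 0)) * planeGen α 1) := by
      rw [e2, e0, e1]; module
    have h4' : (4 : ℝ) • x = (4 : ℝ) • (s • 1) := by
      rw [h4, hstuv, planeGen_zero_eq, planeGen_one_eq]
      simp only [planeElt_mul, mul_smul_comm, smul_mul_assoc]
      simp only [planeElt]
      rcases hα with rfl | rfl <;> (norm_num; module)
    exact smul_right_injective _ (by norm_num : (4 : ℝ) ≠ 0) h4'
  -- The twisted norm of the scalar `s` is `s²`, so the value `-1` is impossible.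
  have hs : s = 1 ∨ s = -1 := by
    have hP := b.2.2
    rw [← hx, hxs, CliffordAlgebra.star_smul, star_one, smul_mul_smul_comm, one_mul] at hP
    rcases hP with hP | hP
    · rw [← one_smul ℝ (1 : CliffordAlgebra (planeForm α)), smul_smul, mul_one] at hP
      have := smul_one_inj hP
      exact mul_self_eq_one_iff.1 this
    · rw [← neg_one_smul ℝ (1 : CliffordAlgebra (planeForm α))] at hP
      have := smul_one_inj hP
      nlinarith
  rcases hs with rfl | rfl
  · left; ext; rw [← hx, hxs]; simp
  · right; ext; rw [← hx, hxs]; simp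

/-- An element of `Pin₂(α)` that respects, up to an upper triangular matrix with positive diagonal,
the frame `(e₁, e₂)` is `±1`. -/
theorem eq_one_or_neg_one_of_triangular (hα : α = 1 ∨ α = -1) (b : Pin (planeForm α))
    {r c d r' c' d' : ℝ} (hr : 0 < r) (hd : 0 < d) (hr' : 0 < r') (hd' : 0 < d')
    (h0 : r • planeGen α 0 = (b : (CliffordAlgebra (planeForm α))ˣ) * (r' • planeGen α 0) *
      ((b : (CliffordAlgebra (planeForm α))ˣ)⁻¹ : (CliffordAlgebra (planeForm α))ˣ))
    (h1 : c • planeGen α 0 + d • planeGen α 1 = (b : (CliffordAlgebra (planeForm α))ˣ) *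
      (c' • planeGen α 0 + d' • planeGen α 1) *
      ((b : (CliffordAlgebra (planeForm α))ˣ)⁻¹ : (CliffordAlgebra (planeForm α))ˣ)) :
    (b : (CliffordAlgebra (planeForm α))ˣ) = 1 ∨ (b : (CliffordAlgebra (planeForm α))ˣ) = -1 := by
  have hα0 : α ≠ 0 := by rcases hα with rfl | rfl <;> norm_num
  set u : (CliffordAlgebra (planeForm α))ˣ := (b : (CliffordAlgebra (planeForm α))ˣ) with hu
  have conj_mul : ∀ x y : CliffordAlgebra (planeForm α),
      (u * x * (u⁻¹ : (CliffordAlgebra (planeForm α))ˣ)) *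
        (u * y * (u⁻¹ : (CliffordAlgebra (planeForm α))ˣ))
        = u * (x * y) * (u⁻¹ : (CliffordAlgebra (planeForm α))ˣ) := fun x y => by
    simp [mul_assoc]
  have hcomm : ∀ x : CliffordAlgebra (planeForm α),
      u * x * (u⁻¹ : (CliffordAlgebra (planeForm α))ˣ) = x → (u : CliffordAlgebra (planeForm α)) * x
        = x * u := fun x hx => by
    conv_rhs => rw [← hx]
    simp [mul_assoc]
  -- Conjugation preserves squares, so `α r² = α r'²`; positivity decides the sign.
  have hrr : r = r' := by
    have h2 : (r • planeGen α 0) * (r • planeGen α 0)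
        = u * ((r' • planeGen α 0) * (r' • planeGen α 0)) *
          (u⁻¹ : (CliffordAlgebra (planeForm α))ˣ) := by rw [← conj_mul, ← h0]
    simp only [planeGen_mul_self, smul_smul, mul_smul_comm, smul_mul_assoc, mul_one, Units.mul_inv,
      ← mul_assoc] at h2
    have := mul_right_cancel₀ hα0 (smul_one_inj h2)
    nlinarith
  have g0 : u * planeGen α 0 * (u⁻¹ : (CliffordAlgebra (planeForm α))ˣ) = planeGen α 0 := by
    rw [← hrr, mul_smul_comm, smul_mul_assoc] at h0
    exact (smul_right_injective _ hr.ne' h0).symm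
  set f := u * planeGen α 1 * (u⁻¹ : (CliffordAlgebra (planeForm α))ˣ) with hf
  have hfe : d' • f = (c - c') • planeGen α 0 + d • planeGen α 1 := by
    have : c • planeGen α 0 + d • planeGen α 1 = c' • planeGen α 0 + d' • f := by
      rw [h1, mul_add, add_mul, mul_smul_comm, smul_mul_assoc, mul_smul_comm, smul_mul_assoc, g0]
    rw [sub_smul, sub_add_eq_add_sub, this]; abel
  have hanti : f * planeGen α 0 + planeGen α 0 * f = 0 := by
    nth_rewrite 1 [← g0]
    nth_rewrite 2 [← g0]
    rw [hf, conj_mul, conj_mul, ← add_mul, ← mul_add, planeGen_anticomm]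
    simp
  -- The conjugate of `e₂` still anticommutes with `e₁`, hence has no `e₁` component.
  have hk : c - c' = 0 := by
    have h2 : (d' • f) * planeGen α 0 + planeGen α 0 * (d' • f) = 0 := by
      rw [smul_mul_assoc, mul_smul_comm, ← smul_add, hanti, smul_zero]
    rw [hfe] at h2
    simp only [add_mul, mul_add, smul_mul_assoc, mul_smul_comm, planeGen_mul_self,
      planeGen_anticomm] at h2
    have h3 : (2 * ((c - c') * α)) • (1 : CliffordAlgebra (planeForm α)) = (0 : ℝ) • 1 := by
      rw [zero_smul, ← h2]; module
    have h4 := smul_one_inj h3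
    simpa [hα0] using h4
  have hdd : d = d' := by
    have h2 : (d' • f) * (d' • f) = (d' * d' * α) • 1 := by
      rw [smul_mul_smul_comm, hf, conj_mul, planeGen_mul_self, mul_smul_comm, smul_mul_assoc]
      simp [smul_smul]
    rw [hfe, hk, zero_smul, zero_add, smul_mul_smul_comm, planeGen_mul_self, smul_smul] at h2
    have := mul_right_cancel₀ hα0 (smul_one_inj h2)
    nlinarith
  have g1 : f = planeGen α 1 := by
    rw [hk, zero_smul, zero_add, hdd] at hfe
    exact smul_right_injective _ hd'.ne' hfe
  exact eq_one_or_neg_one_of_commute hα b (hcomm _ g0) (hcomm _ (hf ▸ g1))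

end Plane

/-! ### Commutant and anticommutant of the elementary representation -/

section Commutant

variable {V : Type*} [AddCommGroup V] [Module ℝ V] {h : QuadraticForm ℝ V} {α : ℝ}
  {S₀ : Type*} [NormedAddCommGroup S₀] [NormedSpace ℝ S₀]
  {γ₀ : CliffordAlgebra h →ₐ[ℝ] (S₀ →L[ℝ] S₀)}
  {γ₂ : CliffordAlgebra (planeForm α) →ₐ[ℝ] (S₀ →L[ℝ] S₀)}

theorem commute_of_commute_ι {T : S₀ →L[ℝ] S₀}
    (hT : ∀ v, T * γ₀ (CliffordAlgebra.ι h v) = γ₀ (CliffordAlgebra.ι h v) * T)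
    (x : CliffordAlgebra h) : T * γ₀ x = γ₀ x * T := by
  induction x using CliffordAlgebra.induction with
  | algebraMap r => rw [AlgHom.commutes]; exact (Algebra.commutes r T).symm
  | ι v => exact hT v
  | mul a b ha hb => rw [map_mul, ← mul_assoc, ha, mul_assoc, hb, mul_assoc]
  | add a b ha hb => rw [map_add, mul_add, add_mul, ha, hb]

/-- Anticommuting with vectors means intertwining `γ₀` with its twist by the grading involution. In
particular such a `T` commutes with the even part, where `Spin` lives. -/
theorem mul_eq_involute_mul {T : S₀ →L[ℝ] S₀}
    (hT : ∀ v, T * γ₀ (CliffordAlgebra.ι h v) = -(γ₀ (CliffordAlgebra.ι h v) * T))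
    (x : CliffordAlgebra h) : T * γ₀ x = γ₀ (CliffordAlgebra.involute x) * T := by
  induction x using CliffordAlgebra.induction with
  | algebraMap r =>
    rw [AlgHom.commutes CliffordAlgebra.involute, AlgHom.commutes γ₀]
    exact (Algebra.commutes r T).symm
  | ι v => rw [hT, CliffordAlgebra.involute_ι, map_neg, neg_mul]
  | mul a b ha hb => rw [map_mul, ← mul_assoc, ha, mul_assoc, hb, map_mul, map_mul, mul_assoc]
  | add a b ha hb => rw [map_add, mul_add, ha, hb, map_add, map_add, add_mul]

/-- Schur's lemma: the kernel of an intertwiner is invariant, so by irreducibility it is zero or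
everything. -/
theorem eq_zero_of_commute (hγ₀ : IsElementary γ₀) {T : S₀ →L[ℝ] S₀}
    (hT : ∀ x, T * γ₀ x = γ₀ x * T) {v : S₀} (hv : v ≠ 0) (hTv : T v = 0) : T = 0 := by
  rcases hγ₀.2 (LinearMap.ker (T : S₀ →ₗ[ℝ] S₀)) (fun c x hx => by
    have hx' : T x = 0 := hx
    change T (γ₀ c x) = 0
    rw [← mul_apply_eq_comp, hT, mul_apply_eq_comp, hx', map_zero])
    with h0 | h0
  · have : v ∈ LinearMap.ker (T : S₀ →ₗ[ℝ] S₀) := hTv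
    rw [h0] at this
    exact absurd ((Submodule.mem_bot ℝ).1 this) hv
  · ext w
    have : w ∈ LinearMap.ker (T : S₀ →ₗ[ℝ] S₀) := by rw [h0]; trivial
    exact this

/-- With `J` as complex structure, `T` is complex linear and has an eigenvalue `μ`. The intertwiner
`T - μ` has a kernel, hence vanishes. -/
theorem exists_eq_of_commute [FiniteDimensional ℝ S₀] (hγ₀ : IsElementary γ₀)
    {J : S₀ →L[ℝ] S₀} (hJ : J * J = -1) (hJc : ∀ x, J * γ₀ x = γ₀ x * J)
    {T : S₀ →L[ℝ] S₀} (hTJ : T * J = J * T) (hT : ∀ x, T * γ₀ x = γ₀ x * T) :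
    ∃ a b : ℝ, T = a • 1 + b • J := by
  have := hγ₀.1
  let f : ℂ →ₐ[ℝ] (S₀ →L[ℝ] S₀) := Complex.lift ⟨J, hJ⟩
  have hf : ∀ z : ℂ, f z = z.re • 1 + z.im • J := fun z => by
    simp [f, Complex.lift_apply, Complex.liftAux_apply, Algebra.algebraMap_eq_smul_one]
  have hfT : ∀ z, T * f z = f z * T := fun z => by
    rw [hf, mul_add, add_mul, mul_smul_comm, mul_smul_comm, hTJ, smul_mul_assoc, smul_mul_assoc,
      one_mul, mul_one]
  have hfx : ∀ z x, (T - f z) * γ₀ x = γ₀ x * (T - f z) := fun z x => by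
    rw [hf, sub_mul, mul_sub, hT, add_mul, mul_add, smul_mul_assoc, smul_mul_assoc, hJc,
      mul_smul_comm, mul_smul_comm, one_mul, mul_one]
  let g : ℂ →+* Module.End ℝ S₀ :=
    (ContinuousLinearMap.toLinearMapRingHom (R₁ := ℝ) (M₁ := S₀)).comp f.toRingHom
  let _ : Module ℂ S₀ := Module.compHom S₀ g
  have hsmul : ∀ (z : ℂ) (v : S₀), z • v = f z v := fun z v => rfl
  have : IsScalarTower ℝ ℂ S₀ := ⟨fun r z v => by
    rw [hsmul, hsmul, map_smul, smul_apply]⟩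
  have : Module.Finite ℂ S₀ := Module.Finite.of_restrictScalars_finite ℝ ℂ S₀
  let T' : Module.End ℂ S₀ :=
    { toFun := T
      map_add' := map_add T
      map_smul' := fun z v => congrArg (fun L : S₀ →L[ℝ] S₀ => L v) (hfT z) }
  obtain ⟨μ, hμ⟩ := Module.End.exists_eigenvalue T'
  obtain ⟨v, hv⟩ := hμ.exists_hasEigenvector
  have hTv : (T - f μ) v = 0 := by
    rw [sub_apply, sub_eq_zero]
    exact hv.apply_eq_smul
  have h0 := eq_zero_of_commute hγ₀ (hfx μ) hv.2 hTv
  exact ⟨μ.re, μ.im, by rw [← hf]; exact sub_eq_zero.1 h0⟩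

/-- The facts about `γ₀` and `γ₂` that the theory of the twist bundle rests on. -/
structure TwistData (γ₀ : CliffordAlgebra h →ₐ[ℝ] (S₀ →L[ℝ] S₀))
    (γ₂ : CliffordAlgebra (planeForm α) →ₐ[ℝ] (S₀ →L[ℝ] S₀)) : Prop where
  commute_even : ∀ x ∈ CliffordAlgebra.even h, ∀ c, γ₂ c * γ₀ x = γ₀ x * γ₂ c
  injective : Function.Injective γ₂
  commute_iff : ∀ T : S₀ →L[ℝ] S₀,
    (∀ v, T * γ₀ (CliffordAlgebra.ι h v) = γ₀ (CliffordAlgebra.ι h v) * T) ↔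
      ∃ a d : ℝ, T = γ₂ (planeElt α a 0 0 d)
  anticommute_iff : ∀ T : S₀ →L[ℝ] S₀,
    (∀ v, T * γ₀ (CliffordAlgebra.ι h v) = -(γ₀ (CliffordAlgebra.ι h v) * T)) ↔
      ∃ w, T = γ₂ (CliffordAlgebra.ι (planeForm α) w)

/-- The commutant is `ℝ ⊕ ℝJ` by Schur, and right multiplication by the invertible `D` carries the
anticommutant into it. The images of `1, e₁, e₂, e₁e₂` are `1, D, -αJD, J`. -/
theorem IsCompatible.twistData [FiniteDimensional ℝ S₀] (hα : α = 1 ∨ α = -1)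
    (hodd : Odd (Module.finrank ℝ V)) (hγ₀ : IsElementary γ₀) (hγ₂ : IsCompatible h α γ₀ γ₂) :
    TwistData γ₀ γ₂ := by
  have := hγ₀.1
  have hα2 : α * α = 1 := by rcases hα with rfl | rfl <;> norm_num
  have hα0 : α ≠ 0 := by rintro rfl; simp at hα2
  obtain ⟨c, D, hc, hDJ, hDv, hDD, h0, h1⟩ := hγ₂
  set J := γ₀ c with hJ
  have hJc : ∀ x, J * γ₀ x = γ₀ x * J := fun x => by
    rw [hJ, ← map_mul, ← map_mul, hc.commute hodd]
  have hD0 : D ≠ 0 := by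
    rintro rfl
    rw [mul_zero] at hDD
    exact smul_ne_zero hα0 one_ne_zero hDD.symm
  -- A nonzero scalar cannot anticommute with `D ≠ 0`.
  have hJne : ∀ r : ℝ, J ≠ r • 1 ∨ r = 0 := fun r => by
    by_contra! hr
    rw [hr.1, mul_smul_comm, smul_mul_assoc, one_mul, mul_one, eq_neg_iff_add_eq_zero,
      ← two_smul ℝ, smul_smul] at hDJ
    exact smul_ne_zero (mul_ne_zero two_ne_zero hr.2) hD0 hDJ
  have hJJ : J * J = -1 := by
    rcases hc.sq with hs | hs
    · exfalso
      have hJ1 : J * J = 1 := by rw [hJ, ← map_mul, hs, map_one]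
      obtain ⟨v, hv⟩ := exists_ne (0 : S₀)
      -- If `J² = 1`, then either `J - 1` kills `v` or `J + 1` kills `J v - v ≠ 0`. In both cases
      -- Schur makes `J` equal to `±1`.
      by_cases hw : J v - v = 0
      · have := eq_zero_of_commute hγ₀ (T := J - 1)
          (fun x => by rw [sub_mul, mul_sub, hJc, one_mul, mul_one]) hv hw
        rcases hJne 1 with h' | h'
        · exact h' (by rw [one_smul]; exact sub_eq_zero.1 this)
        · exact one_ne_zero h'
      · have := eq_zero_of_commute hγ₀ (T := J + 1)
          (fun x => by rw [add_mul, mul_add, hJc, one_mul, mul_one]) hw (by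
            have hJJv : J (J v) = v := congrArg (fun L : S₀ →L[ℝ] S₀ => L v) hJ1
            simp only [add_apply, one_apply_eq_self, map_sub, hJJv]
            abel)
        rcases hJne (-1) with h' | h'
        · exact h' (by rw [neg_one_smul]; exact eq_neg_of_add_eq_zero_left this)
        · norm_num at h'
    · rw [hJ, ← map_mul, hs, map_neg, map_one]
  have hJDv : ∀ v, (J * D) * γ₀ (CliffordAlgebra.ι h v)
      = -(γ₀ (CliffordAlgebra.ι h v) * (J * D)) := fun v => by
    rw [mul_assoc, hDv, mul_neg, ← mul_assoc, hJc, mul_assoc]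
  have h01 : γ₂ (planeGen α 0 * planeGen α 1) = J := by
    rw [map_mul, h0, h1, mul_neg, mul_smul_comm, ← mul_assoc, hDJ, neg_mul, smul_neg, neg_neg,
      mul_assoc, hDD, mul_smul_comm, mul_one, smul_smul, hα2, one_smul]
  have hγ₂e : ∀ a b c d : ℝ, γ₂ (planeElt α a b c d)
      = a • 1 + b • D + c • (-(α • (J * D))) + d • J := fun a b c d => by
    simp only [planeElt, map_add, map_smul, map_one, h0, h1, h01]
  have hevencomm : ∀ a d : ℝ, ∀ x, γ₂ (planeElt α a 0 0 d) * γ₀ x = γ₀ x * γ₂ (planeElt α a 0 0 d) :=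
    fun a d x => by
      simp [hγ₂e, add_mul, mul_add, hJc]
  have hoddanti : ∀ b c : ℝ, ∀ v, γ₂ (planeElt α 0 b c 0) * γ₀ (CliffordAlgebra.ι h v)
      = -(γ₀ (CliffordAlgebra.ι h v) * γ₂ (planeElt α 0 b c 0)) := fun b c v => by
    have e : γ₂ (planeElt α 0 b c 0) = b • D + (-(c * α)) • (J * D) := by
      rw [hγ₂e]; module
    rw [e, add_mul, mul_add, smul_mul_assoc, smul_mul_assoc, hDv, hJDv, mul_smul_comm,
      mul_smul_comm, smul_neg, smul_neg, neg_add]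
  have hcomm : ∀ T : S₀ →L[ℝ] S₀,
      (∀ v, T * γ₀ (CliffordAlgebra.ι h v) = γ₀ (CliffordAlgebra.ι h v) * T) →
      ∃ a d : ℝ, T = γ₂ (planeElt α a 0 0 d) := fun T hT => by
    have hT' := commute_of_commute_ι hT
    obtain ⟨a, d, rfl⟩ := exists_eq_of_commute hγ₀ hJJ hJc (hT' c) hT'
    exact ⟨a, d, by simp [hγ₂e]⟩
  refine ⟨?_, ?_, fun T => ⟨hcomm T, ?_⟩, fun T => ⟨fun hT => ?_, ?_⟩⟩
  · intro x hx y
    obtain ⟨a, b, c, d, rfl⟩ := exists_eq_planeElt y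
    have e : planeElt α a b c d = planeElt α a 0 0 d + planeElt α 0 b c 0 := by
      simp only [planeElt]; module
    rw [e, map_add, add_mul, mul_add, hevencomm, mul_eq_involute_mul (hoddanti b c),
      CliffordAlgebra.involute_eq_of_mem_even hx]
  · rw [injective_iff_map_eq_zero]
    intro y hy
    obtain ⟨a, b, c, d, rfl⟩ := exists_eq_planeElt y
    have e : γ₂ (planeElt α a b c d)
        = (a • 1 + d • J) + (b • D + (-(c * α)) • (J * D)) := by rw [hγ₂e]; module
    rw [e] at hy
    have hanti : D * J + J * D = 0 := by rw [hDJ]; abel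
    have hJDJ : J * D * J = D := by
      rw [mul_assoc, hDJ, mul_neg, ← mul_assoc, hJJ]; simp
    have hJJD : J * (J * D) = -D := by rw [← mul_assoc, hJJ]; simp
    -- The commutator with `J` annihilates the `J`-linear part and sends the antilinear part `X` to
    -- `2JX`, so the two parts vanish separately.
    have h2 : J * ((a • 1 + d • J) + (b • D + (-(c * α)) • (J * D)))
        - ((a • 1 + d • J) + (b • D + (-(c * α)) • (J * D))) * J = 0 := by rw [hy]; simp
    have h3 : (2 : ℝ) • (J * (b • D + (-(c * α)) • (J * D))) = 0 := by
      rw [← h2]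
      simp only [mul_add, add_mul, mul_smul_comm, smul_mul_assoc, hJDJ, hJJD, mul_one, one_mul, hDJ]
      module
    have h4 : b • D + (-(c * α)) • (J * D) = 0 := by
      have h5 : J * (b • D + (-(c * α)) • (J * D)) = 0 := (smul_eq_zero.1 h3).resolve_left two_ne_zero
      have := congrArg (J * ·) h5
      simp only [← mul_assoc, hJJ, mul_zero, neg_mul, one_mul, neg_eq_zero] at this
      exact this
    have key : ∀ s t : ℝ, s • (1 : S₀ →L[ℝ] S₀) + t • J = 0 → s = 0 ∧ t = 0 := by
      intro s t hst
      by_cases ht : t = 0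
      · subst ht
        rw [zero_smul, add_zero] at hst
        exact ⟨(smul_eq_zero.1 hst).resolve_right one_ne_zero, rfl⟩
      · exfalso
        have hJs : J = (-(t⁻¹ * s)) • 1 := by
          have := congrArg (t⁻¹ • ·) hst
          simp only [smul_add, smul_smul, inv_mul_cancel₀ ht, one_smul, smul_zero] at this
          rw [neg_smul]; exact eq_neg_of_add_eq_zero_right this
        have hsq := hJJ
        rw [hJs, smul_mul_smul_comm, one_mul, ← neg_one_smul ℝ (1 : S₀ →L[ℝ] S₀)] at hsq
        have := smul_left_injective ℝ (one_ne_zero (α := S₀ →L[ℝ] S₀)) hsq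
        nlinarith
    rw [h4, add_zero] at hy
    obtain ⟨rfl, rfl⟩ := key _ _ hy
    have h6 : (b * α) • (1 : S₀ →L[ℝ] S₀) + (-(c * α) * α) • J = 0 := by
      have := congrArg (· * D) h4
      simpa only [add_mul, smul_mul_assoc, mul_assoc, hDD, smul_smul, mul_smul_comm, mul_one,
        zero_mul] using this
    obtain ⟨h7, h8⟩ := key _ _ h6
    have hb : b = 0 := (mul_eq_zero.1 h7).resolve_right hα0
    have hc0 : c = 0 := by simpa [hα0] using h8
    subst hb hc0
    simp [planeElt]
  · rintro ⟨a, d, rfl⟩ v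
    exact hevencomm a d _
  · obtain ⟨a, d, had⟩ := hcomm (T * D) (fun v => by
      rw [mul_assoc, hDv, mul_neg, ← mul_assoc, hT, neg_mul, neg_neg, mul_assoc])
    -- From `TD = a + dJ` and `D² = α` one gets `T = αaD + αdJD`, while `e₂` maps to `-αJD`.
    refine ⟨![α * a, -d], ?_⟩
    have hTD : T = α • (T * D * D) := by
      rw [mul_assoc, hDD, mul_smul_comm, mul_one, smul_smul, hα2, one_smul]
    rw [ι_eq_planeElt, hTD, had, hγ₂e, hγ₂e]
    simp only [Matrix.cons_val_zero, Matrix.cons_val_one, zero_smul, add_zero, zero_add, add_mul,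
      smul_mul_assoc, one_mul]
    module
  · rintro ⟨w, rfl⟩ v
    rw [ι_eq_planeElt]
    exact hoddanti _ _ v

end Commutant

/-! ### Smooth maps into vector spaces and into the spin groups -/

section SmoothMaps

variable {E : Type*} [NormedAddCommGroup E] [NormedSpace ℝ E]
  {M : Type*} [TopologicalSpace M] [ChartedSpace E M]
  {W : Type*} [AddCommGroup W] [Module ℝ W] {W' : Type*} [AddCommGroup W'] [Module ℝ W']
  {f f' : M → W} {U U' : Set M}

theorem SmoothVec.mono (hf : SmoothVec E f U) (hU : U' ⊆ U) : SmoothVec E f U' :=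
  fun l => (hf l).mono hU

theorem SmoothVec.congr (hf : SmoothVec E f U) (h : ∀ x ∈ U, f' x = f x) : SmoothVec E f' U :=
  fun l => (hf l).congr fun x hx => by rw [h x hx]

theorem smoothVec_const (w : W) : SmoothVec E (fun _ : M => w) U :=
  fun _ => contMDiffOn_const

theorem SmoothVec.add (hf : SmoothVec E f U) (hf' : SmoothVec E f' U) :
    SmoothVec E (fun x => f x + f' x) U := fun l => by
  simp only [map_add]
  exact (hf l).add (hf' l)

theorem SmoothVec.smul {c : M → ℝ} (hc : ContMDiffOn 𝓘(ℝ, E) 𝓘(ℝ, ℝ) ∞ c U)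
    (hf : SmoothVec E f U) : SmoothVec E (fun x => c x • f x) U := fun l => by
  simp only [map_smul]
  exact hc.smul (hf l)

theorem SmoothVec.linear (L : W →ₗ[ℝ] W') (hf : SmoothVec E f U) :
    SmoothVec E (fun x => L (f x)) U :=
  fun l => hf (l ∘ₗ L)

theorem SmoothVec.of_local
    (hf : ∀ x ∈ U, ∃ O, IsOpen O ∧ x ∈ O ∧ SmoothVec E f (O ∩ U)) : SmoothVec E f U := by
  intro l x hx
  obtain ⟨O, hO, hxO, h⟩ := hf x hx
  have := h l x ⟨hxO, hx⟩
  rwa [inter_comm, contMDiffWithinAt_inter (hO.mem_nhds hxO)] at this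

/-- Expanding both arguments in bases gives a finite sum of products of smooth coordinates. No
topology on `W` is involved, so this applies to Clifford algebras. -/
theorem SmoothVec.bilinear [FiniteDimensional ℝ W] [FiniteDimensional ℝ W']
    {W'' : Type*} [AddCommGroup W''] [Module ℝ W''] (B : W →ₗ[ℝ] W' →ₗ[ℝ] W'') {g : M → W'}
    (hf : SmoothVec E f U) (hg : SmoothVec E g U) : SmoothVec E (fun x => B (f x) (g x)) U := by
  intro l
  let b := Module.finBasis ℝ W
  let b' := Module.finBasis ℝ W'
  have key : ∀ x, l (B (f x) (g x))
      = ∑ i, ∑ j, (b.coord i (f x) * b'.coord j (g x)) * l (B (b i) (b' j)) := by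
    intro x
    conv_lhs => rw [← b.sum_repr (f x), ← b'.sum_repr (g x)]
    simp only [map_sum, map_smul, LinearMap.sum_apply, LinearMap.smul_apply, Finset.smul_sum,
      smul_eq_mul, Module.Basis.coord_apply]
    rw [Finset.sum_comm]
    refine Finset.sum_congr rfl fun i _ => Finset.sum_congr rfl fun j _ => by ring
  simp only [key]
  exact contMDiffOn_finsetSum fun i _ => contMDiffOn_finsetSum fun j _ =>
    ((hf _).mul (hg _)).mul contMDiffOn_const

theorem SmoothVec.mul {A : Type*} [Ring A] [Algebra ℝ A] [FiniteDimensional ℝ A] {f g : M → A}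
    (hf : SmoothVec E f U) (hg : SmoothVec E g U) : SmoothVec E (fun x => f x * g x) U :=
  SmoothVec.bilinear (LinearMap.mul ℝ A) hf hg

theorem smoothVec_iff_contMDiffOn {F : Type*} [NormedAddCommGroup F] [NormedSpace ℝ F]
    [FiniteDimensional ℝ F] {f : M → F} :
    SmoothVec E f U ↔ ContMDiffOn 𝓘(ℝ, E) 𝓘(ℝ, F) ∞ f U := by
  constructor
  · intro hf
    let b := Module.finBasis ℝ F
    have key : f = fun x => ∑ i, b.coord i (f x) • b i := by
      ext x
      simp [b.sum_repr]
    rw [key]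
    exact contMDiffOn_finsetSum fun i _ => (hf _).smul contMDiffOn_const
  · intro hf l
    exact ((LinearMap.toContinuousLinearMap l).contMDiff.comp_contMDiffOn hf)

/-- Such a functional reads the sign off an element known to be `±1`, so that the sign depends
smoothly on the element. -/
theorem exists_dual_one_eq_one (A : Type*) [Ring A] [Nontrivial A] [Algebra ℝ A] :
    ∃ l : Module.Dual ℝ A, l 1 = 1 :=
  Module.Projective.exists_dual_eq_one ℝ one_ne_zero

variable {V : Type*} [AddCommGroup V] [Module ℝ V]
  {h : QuadraticForm ℝ V} {α : ℝ}

/-- The inverse is `±x̃`, with the sign equal to the twisted norm. This single polynomial formula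
makes inversion smooth on `Pin`. -/
theorem Pin.inv_eq {l : Module.Dual ℝ (CliffordAlgebra h)} (hl : l 1 = 1)
    {x : (CliffordAlgebra h)ˣ} (hx : x ∈ Pin h) :
    ((x⁻¹ : (CliffordAlgebra h)ˣ) : CliffordAlgebra h)
      = l (star (x : CliffordAlgebra h) * x) • star (x : CliffordAlgebra h) := by
  rcases hx.2 with h1 | h1
  · rw [h1, hl, one_smul]
    exact Units.inv_eq_of_mul_eq_one_left h1
  · rw [h1, map_neg, hl, neg_one_smul]
    exact Units.inv_eq_of_mul_eq_one_left (by rw [neg_mul, h1, neg_neg])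

theorem smoothVec_inv [FiniteDimensional ℝ V] {f : M → (CliffordAlgebra h)ˣ} (hf : ∀ x, f x ∈ Pin h)
    (hs : SmoothVec E (fun x => (f x : CliffordAlgebra h)) U) :
    SmoothVec E (fun x => (((f x)⁻¹ : (CliffordAlgebra h)ˣ) : CliffordAlgebra h)) U := by
  obtain ⟨l, hl⟩ := exists_dual_one_eq_one (CliffordAlgebra h)
  have hstar : SmoothVec E (fun x => star (f x : CliffordAlgebra h)) U :=
    hs.linear ((CliffordAlgebra.reverse (Q := h)) ∘ₗ CliffordAlgebra.involute.toLinearMap)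
  exact (hstar.smul ((hstar.mul hs) l)).congr fun x _ => Pin.inv_eq hl (hf x)

theorem SmoothSpinO.mono {f : M → SpinOGroup h α} (hf : SmoothSpinO E h α f U) (hU : U' ⊆ U) :
    SmoothSpinO E h α f U' := by
  intro x hx
  obtain ⟨O, a, b, hO, hxO, ha, hb, hab⟩ := hf x (hU hx)
  have hsub := inter_subset_inter_right O hU
  exact ⟨O, a, b, hO, hxO, SmoothVec.mono ha hsub, SmoothVec.mono hb hsub,
    fun y hy => hab y (hsub hy)⟩

theorem SmoothSpinO.of_local {f : M → SpinOGroup h α}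
    (hf : ∀ x ∈ U, ∃ O, IsOpen O ∧ x ∈ O ∧ SmoothSpinO E h α f (O ∩ U)) :
    SmoothSpinO E h α f U := by
  intro x hx
  obtain ⟨O, hO, hxO, h⟩ := hf x hx
  obtain ⟨O', a, b, hO', hxO', ha, hb, hab⟩ := h x ⟨hxO, hx⟩
  rw [← inter_assoc] at ha hb hab
  exact ⟨O' ∩ O, a, b, hO'.inter hO, ⟨hxO', hxO⟩, ha, hb, hab⟩

theorem SmoothSpinO.mk {a : M → Spin h} {b : M → Pin (planeForm α)} (ha : SmoothSpin E h a U)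
    (hb : SmoothPin E (planeForm α) b U) :
    SmoothSpinO E h α (fun x => SpinOGroup.mk h α (a x) (b x)) U :=
  fun x hx => ⟨univ, a, b, isOpen_univ, trivial, by rwa [univ_inter], by rwa [univ_inter],
    fun _ _ => rfl⟩

theorem SmoothSpinO.mul [FiniteDimensional ℝ V] {f g : M → SpinOGroup h α} (hf : SmoothSpinO E h α f U)
    (hg : SmoothSpinO E h α g U) : SmoothSpinO E h α (fun x => f x * g x) U := by
  intro x hx
  obtain ⟨O, a, b, hO, hxO, ha, hb, hab⟩ := hf x hx
  obtain ⟨O', a', b', hO', hxO', ha', hb', hab'⟩ := hg x hx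
  have h1 : O ∩ O' ∩ U ⊆ O ∩ U := fun y hy => ⟨hy.1.1, hy.2⟩
  have h2 : O ∩ O' ∩ U ⊆ O' ∩ U := fun y hy => ⟨hy.1.2, hy.2⟩
  refine ⟨O ∩ O', fun y => a y * a' y, fun y => b y * b' y, hO.inter hO', ⟨hxO, hxO'⟩, ?_, ?_,
    fun y hy => by
      change f y * g y = _
      rw [hab y (h1 hy), hab' y (h2 hy)]
      rfl⟩
  · exact SmoothVec.mul (SmoothVec.mono ha h1) (SmoothVec.mono ha' h2)
  · exact SmoothVec.mul (SmoothVec.mono hb h1) (SmoothVec.mono hb' h2)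

theorem SmoothSpinO.inv [FiniteDimensional ℝ V] {f : M → SpinOGroup h α} (hf : SmoothSpinO E h α f U) :
    SmoothSpinO E h α (fun x => (f x)⁻¹) U := by
  intro x hx
  obtain ⟨O, a, b, hO, hxO, ha, hb, hab⟩ := hf x hx
  refine ⟨O, fun y => (a y)⁻¹, fun y => (b y)⁻¹, hO, hxO, ?_, ?_,
    fun y hy => by
      change (f y)⁻¹ = _
      rw [hab y hy]
      rfl⟩
  · exact smoothVec_inv (f := fun y => (a y : (CliffordAlgebra h)ˣ)) (fun y => (a y).2.1) ha
  · exact smoothVec_inv (f := fun y => (b y : (CliffordAlgebra (planeForm α))ˣ))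
      (fun y => (b y).2) hb

theorem SmoothSpinO.congr {f g : M → SpinOGroup h α} (hf : SmoothSpinO E h α f U)
    (hg : ∀ x ∈ U, g x = f x) : SmoothSpinO E h α g U := by
  intro x hx
  obtain ⟨O, a, b, hO, hxO, ha, hb, hab⟩ := hf x hx
  exact ⟨O, a, b, hO, hxO, ha, hb, fun y hy => by rw [hg y hy.2, hab y hy]⟩

theorem spinInclusion_eq_mk_iff (a a' : Spin h) (b : Pin (planeForm α)) :
    spinInclusion h α a = SpinOGroup.mk h α a' b ↔
      ((a : (CliffordAlgebra h)ˣ) = a' ∧ (b : (CliffordAlgebra (planeForm α))ˣ) = 1) ∨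
      ((a : (CliffordAlgebra h)ˣ) = -a' ∧ (b : (CliffordAlgebra (planeForm α))ˣ) = -1) := by
  have e : spinInclusion h α a = SpinOGroup.mk h α a' b ↔
      ((a, 1) : Spin h × Pin (planeForm α))⁻¹ * (a', b) ∈ signSubgroup h α :=
    QuotientGroup.eq
  rw [e]
  change ((a : (CliffordAlgebra h)ˣ)⁻¹ * a' = 1 ∧
      (1 : (CliffordAlgebra (planeForm α))ˣ)⁻¹ * (b : (CliffordAlgebra (planeForm α))ˣ) = 1) ∨
    ((a : (CliffordAlgebra h)ˣ)⁻¹ * a' = -1 ∧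
      (1 : (CliffordAlgebra (planeForm α))ˣ)⁻¹ * (b : (CliffordAlgebra (planeForm α))ˣ) = -1) ↔ _
  rw [inv_one, one_mul, inv_mul_eq_one, inv_mul_eq_iff_eq_mul, mul_neg, mul_one,
    eq_comm (a := (a' : (CliffordAlgebra h)ˣ)), neg_eq_iff_eq_neg]

theorem spinInclusion_injective : Function.Injective (spinInclusion h α) := by
  intro a a' haa
  rcases (spinInclusion_eq_mk_iff a a' 1).1 haa with h1 | h1
  · exact Subtype.ext h1.1
  · exfalso
    have h2 := congrArg (Units.val) h1.2
    have h3 : (1 : ℝ) • (1 : CliffordAlgebra (planeForm α)) = (-1 : ℝ) • 1 := by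
      rw [one_smul, neg_one_smul]; simpa using h2
    have := smul_one_inj h3
    norm_num at this

/-- A local smooth lift `(a, b)` of `[f, 1]` has `b = ±1` and `f = ±a` with the same sign, so `f =
l(b) a` is smooth. -/
theorem SmoothSpinO.smoothSpin {f : M → Spin h}
    (hf : SmoothSpinO E h α (fun x => spinInclusion h α (f x)) U) : SmoothSpin E h f U := by
  obtain ⟨l, hl⟩ := exists_dual_one_eq_one (CliffordAlgebra (planeForm α))
  refine SmoothVec.of_local fun x hx => ?_
  obtain ⟨O, a, b, hO, hxO, ha, hb, hab⟩ := hf x hx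
  refine ⟨O, hO, hxO, (SmoothVec.smul (hb l) ha).congr fun y hy => ?_⟩
  change _ = l ((b y : (CliffordAlgebra (planeForm α))ˣ) : CliffordAlgebra (planeForm α)) • _
  rcases (spinInclusion_eq_mk_iff _ _ _).1 (hab y hy) with ⟨h1, h2⟩ | ⟨h1, h2⟩
  · rw [h1, h2, Units.val_one, hl, one_smul]
  · rw [h1, h2, Units.val_neg, Units.val_neg, Units.val_one, map_neg, hl, neg_one_smul]

/-- The twisted vector representation of a smooth family is smooth. -/
theorem SmoothSpinO.smoothVec_twistedVectorRep [FiniteDimensional ℝ V] {f : M → SpinOGroup h α}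
    (hf : SmoothSpinO E h α f U) (v : V) :
    SmoothVec E (fun x => twistedVectorRep h α (f x) v) U := by
  refine SmoothVec.of_local fun x hx => ?_
  obtain ⟨O, a, b, hO, hxO, ha, hb, hab⟩ := hf x hx
  refine ⟨O, hO, hxO, ?_⟩
  have hainv := smoothVec_inv (f := fun y => (a y : (CliffordAlgebra h)ˣ)) (fun y => (a y).2.1) ha
  have hbinv := smoothVec_inv (f := fun y => (b y : (CliffordAlgebra (planeForm α))ˣ))
    (fun y => (b y).2) hb
  have hAda : SmoothVec E (fun y => Ad₀ h (a y : (CliffordAlgebra h)ˣ) v) (O ∩ U) :=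
    ((SmoothVec.mul (SmoothVec.mul ha (smoothVec_const (CliffordAlgebra.ι h v))) hainv).linear
      (vectorPart h))
  have hAdb : ∀ w, SmoothVec E (fun y => Ad₀ (planeForm α)
      (b y : (CliffordAlgebra (planeForm α))ˣ) w) (O ∩ U) := fun w =>
    ((SmoothVec.mul (SmoothVec.mul hb (smoothVec_const (CliffordAlgebra.ι (planeForm α) w)))
      hbinv).linear (vectorPart (planeForm α)))
  have hdet : ContMDiffOn 𝓘(ℝ, E) 𝓘(ℝ, ℝ) ∞ (fun y => LinearMap.det (Ad₀ (planeForm α)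
      (b y : (CliffordAlgebra (planeForm α))ˣ))) (O ∩ U) := by
    simp only [← LinearMap.det_toMatrix', Matrix.det_fin_two, LinearMap.toMatrix'_apply]
    exact (((hAdb _) (LinearMap.proj 0)).mul ((hAdb _) (LinearMap.proj 1))).sub
      (((hAdb _) (LinearMap.proj 0)).mul ((hAdb _) (LinearMap.proj 1)))
  exact (hAda.smul hdet).congr fun y hy => by rw [hab y hy]; rfl

variable {S₀ : Type*} [NormedAddCommGroup S₀] [NormedSpace ℝ S₀] [FiniteDimensional ℝ S₀]

/-- The twisted elementary representation of a smooth family is smooth. -/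
theorem SmoothSpinO.smoothVec_twistedRep {f : M → SpinOGroup h α} (hf : SmoothSpinO E h α f U)
    (γ₀ : CliffordAlgebra h →ₐ[ℝ] (S₀ →L[ℝ] S₀))
    (γ₂ : CliffordAlgebra (planeForm α) →ₐ[ℝ] (S₀ →L[ℝ] S₀)) (s : S₀) :
    SmoothVec E (fun x => twistedRep h α γ₀ γ₂ (f x) s) U := by
  refine SmoothVec.of_local fun x hx => ?_
  obtain ⟨O, a, b, hO, hxO, ha, hb, hab⟩ := hf x hx
  refine ⟨O, hO, hxO, ?_⟩
  have := (SmoothVec.linear γ₀.toLinearMap ha).mul (SmoothVec.linear γ₂.toLinearMap hb)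
  refine (this.linear (ContinuousLinearMap.apply ℝ S₀ s).toLinearMap).congr fun y hy => ?_
  rw [hab y hy]
  rfl

end SmoothMaps

/-! ### Smooth frames of vector bundles -/

section Frames

variable {E : Type*} [NormedAddCommGroup E] [NormedSpace ℝ E]
  {M : Type*} [TopologicalSpace M] [ChartedSpace E M]
  {F : Type*} [NormedAddCommGroup F] [NormedSpace ℝ F]
  {F' : Type*} [NormedAddCommGroup F'] [NormedSpace ℝ F']
  {S : M → Type*} [TopologicalSpace (TotalSpace F S)]
  [∀ x, AddCommGroup (S x)] [∀ x, Module ℝ (S x)] [∀ x, TopologicalSpace (S x)]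
  [FiberBundle F S] [VectorBundle ℝ F S]

theorem contMDiffAt_clm_of_apply [FiniteDimensional ℝ F] {L : M → F →L[ℝ] F'} {x₀ : M}
    (hL : ∀ v, ContMDiffAt 𝓘(ℝ, E) 𝓘(ℝ, F') ∞ (fun x => L x v) x₀) :
    ContMDiffAt 𝓘(ℝ, E) 𝓘(ℝ, F →L[ℝ] F') ∞ L x₀ := by
  let b := Module.finBasis ℝ F
  have key : L = fun x => ∑ i,
      ContinuousLinearMap.smulRightL ℝ F F' (LinearMap.toContinuousLinearMap (b.coord i))
        (L x (b i)) := by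
    ext x v
    conv_lhs => rw [← b.sum_repr v, map_sum]
    simp
  rw [key]
  exact contMDiffAt_finsetSum fun i _ =>
    (ContinuousLinearMap.contMDiff _).contMDiffAt.comp x₀ (hL (b i))

/-- Inversion of continuous linear maps is smooth near an invertible one, so invertibility is needed
only at `x₀`. -/
theorem contMDiffAt_clm_inverse [FiniteDimensional ℝ F] {L : M → F →L[ℝ] F'} {x₀ : M} (e : F ≃L[ℝ] F')
    (he : L x₀ = e) (hL : ContMDiffAt 𝓘(ℝ, E) 𝓘(ℝ, F →L[ℝ] F') ∞ L x₀) :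
    ContMDiffAt 𝓘(ℝ, E) 𝓘(ℝ, F' →L[ℝ] F) ∞ (fun x => (L x).inverse) x₀ := by
  have := FiniteDimensional.complete ℝ F
  have h1 : ContDiffAt ℝ ∞ (ContinuousLinearMap.inverse : (F →L[ℝ] F') → F' →L[ℝ] F) (L x₀) := by
    rw [he]; exact contDiffAt_map_inverse e
  exact h1.contMDiffAt.comp x₀ hL

theorem contMDiffAt_frame_coordinates [FiniteDimensional ℝ F'] {φ : ∀ x, F' ≃L[ℝ] S x} {x₀ : M}
    (hφ : ∀ s, ContMDiffAt 𝓘(ℝ, E) (𝓘(ℝ, E).prod 𝓘(ℝ, F)) ∞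
      (fun x => TotalSpace.mk' F x (φ x s)) x₀) :
    ContMDiffAt 𝓘(ℝ, E) 𝓘(ℝ, F' →L[ℝ] F) ∞
      (fun x => ((trivializationAt F S x₀).continuousLinearMapAt ℝ x).comp
        (φ x : F' →L[ℝ] S x)) x₀ := by
  refine contMDiffAt_clm_of_apply fun s => ?_
  refine ((Bundle.contMDiffAt_section _).1 (hφ s)).congr_of_eventuallyEq ?_
  filter_upwards [(trivializationAt F S x₀).open_baseSet.mem_nhds
    (mem_baseSet_trivializationAt F S x₀)] with x hx
  simp [Trivialization.continuousLinearMapAt_apply, Trivialization.linearMapAt_apply, hx]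

variable [∀ x, IsTopologicalAddGroup (S x)] [∀ x, ContinuousSMul ℝ (S x)]

/-- Conjugation of endomorphisms by a linear isomorphism. -/
def conjEnd {G : Type*} [AddCommGroup G] [Module ℝ G] [TopologicalSpace G]
    [IsTopologicalAddGroup G] [ContinuousSMul ℝ G] (φ : F ≃L[ℝ] G) :
    (F →L[ℝ] F) ≃ₐ[ℝ] (G →L[ℝ] G) :=
  AlgEquiv.ofLinearEquiv
    { toFun := fun T => (φ : F →L[ℝ] G) ∘L T ∘L (φ.symm : G →L[ℝ] F)
      invFun := fun T => (φ.symm : G →L[ℝ] F) ∘L T ∘L (φ : F →L[ℝ] G)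
      map_add' := fun T T' => by ext; simp
      map_smul' := fun c T => by ext; simp
      left_inv := fun T => by ext; simp
      right_inv := fun T => by ext; simp }
    (by ext; simp) (fun T T' => by ext; simp)

@[simp]
theorem conjEnd_apply {G : Type*} [AddCommGroup G] [Module ℝ G] [TopologicalSpace G]
    [IsTopologicalAddGroup G] [ContinuousSMul ℝ G] (φ : F ≃L[ℝ] G) (T : F →L[ℝ] F) (s : G) :
    conjEnd φ T s = φ (T (φ.symm s)) := rfl

/-- In a smooth frame the smooth sections of `End(S)` are the smooth families of matrices. -/
theorem smoothEnd_conjEnd_iff [FiniteDimensional ℝ F] {U : Set M} (hU : IsOpen U) {φ : ∀ x, F ≃L[ℝ] S x}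
    (hφ : ∀ s, ContMDiffOn 𝓘(ℝ, E) (𝓘(ℝ, E).prod 𝓘(ℝ, F)) ∞
      (fun x => TotalSpace.mk' F x (φ x s)) U) (K : M → F →L[ℝ] F) :
    SmoothEnd E F (fun x => conjEnd (φ x) (K x)) U ↔ SmoothVec E K U := by
  rw [smoothVec_iff_contMDiffOn]
  have key : ∀ x₀ ∈ U, ContMDiffAt 𝓘(ℝ, E) (𝓘(ℝ, E).prod 𝓘(ℝ, F →L[ℝ] F)) ∞
      (fun x => TotalSpace.mk' (F →L[ℝ] F) (E := fun x : M => S x →L[ℝ] S x) x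
        (conjEnd (φ x) (K x))) x₀ ↔ ContMDiffAt 𝓘(ℝ, E) 𝓘(ℝ, F →L[ℝ] F) ∞ K x₀ := by
    intro x₀ hx₀
    set e := trivializationAt F S x₀
    have hx₀e : x₀ ∈ e.baseSet := mem_baseSet_trivializationAt F S x₀
    -- `Φ` is the frame read in the trivialization. There the endomorphism becomes `Φ K Φ⁻¹`, and
    -- `Φ` and `Φ⁻¹` are both smooth at `x₀`.
    let Φ : M → F →L[ℝ] F := fun x => (e.continuousLinearMapAt ℝ x).comp (φ x : F →L[ℝ] S x)
    have hΦ : ContMDiffAt 𝓘(ℝ, E) 𝓘(ℝ, F →L[ℝ] F) ∞ Φ x₀ :=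
      contMDiffAt_frame_coordinates fun s => (hφ s).contMDiffAt (hU.mem_nhds hx₀)
    have hΦe : ∀ x (hx : x ∈ e.baseSet),
        Φ x = ((φ x).trans (e.continuousLinearEquivAt ℝ x hx) : F ≃L[ℝ] F) := by
      intro x hx
      ext s
      simp [Φ, Trivialization.linearMapAt_apply, hx]
    have hΨ := contMDiffAt_clm_inverse _ (hΦe x₀ hx₀e) hΦ
    have hΨe : ∀ x (hx : x ∈ e.baseSet), (Φ x).inverse
        = (φ x).symm.toContinuousLinearMap.comp (e.symmL ℝ x) := by
      intro x hx
      rw [hΦe x hx, ContinuousLinearMap.inverse_equiv]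
      ext s
      simp [e.symmL_apply hx]
    have hnhds := e.open_baseSet.mem_nhds hx₀e
    rw [contMDiffAt_hom_bundle]
    constructor
    · rintro ⟨-, h⟩
      have := hΨ.clm_comp (h.clm_comp hΦ)
      refine this.congr_of_eventuallyEq ?_
      filter_upwards [hnhds] with x hx
      rw [hΨe x hx]
      ext s
      have h1 := e.symmL_continuousLinearMapAt (R := ℝ) hx
      change K x s = (φ x).symm (e.symmL ℝ x (e.continuousLinearMapAt ℝ x (φ x (K x
        ((φ x).symm (e.symmL ℝ x (e.continuousLinearMapAt ℝ x (φ x s))))))))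
      rw [h1, h1, ContinuousLinearEquiv.symm_apply_apply, ContinuousLinearEquiv.symm_apply_apply]
    · intro h
      refine ⟨contMDiffAt_id, ?_⟩
      have := hΦ.clm_comp (h.clm_comp hΨ)
      refine this.congr_of_eventuallyEq ?_
      filter_upwards [hnhds] with x hx
      rw [hΨe x hx]
      rfl
  exact ⟨fun h x hx => ((key x hx).1 (h.contMDiffAt (hU.mem_nhds hx))).contMDiffWithinAt,
    fun h x hx => ((key x hx).2 (h.contMDiffAt (hU.mem_nhds hx))).contMDiffWithinAt⟩

end Frames

/-! ### Smooth coframes and their dual frames -/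

section Coframes

variable {E : Type*} [NormedAddCommGroup E] [NormedSpace ℝ E] [FiniteDimensional ℝ E]
  {M : Type*} [TopologicalSpace M] [ChartedSpace E M] [IsManifold 𝓘(ℝ, E) ∞ M]

/-- The frame dual to a smooth coframe is smooth. -/
theorem contMDiffOn_dualFrame {n : ℕ} {U : Set M} (hU : IsOpen U)
    {ξ : Fin n → ∀ x : M, CotangentSpace E x} (hξ : ∀ i, SmoothCovector E (ξ i) U)
    (Θ : ∀ x : M, TangentSpace 𝓘(ℝ, E) x ≃ₗ[ℝ] (Fin n → ℝ))
    (hΘ : ∀ x ∈ U, ∀ v i, Θ x v i = ξ i x v) (w : Fin n → ℝ) :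
    ContMDiffOn 𝓘(ℝ, E) (𝓘(ℝ, E).prod 𝓘(ℝ, E)) ∞
      (fun x => TotalSpace.mk' E x ((Θ x).symm w)) U := by
  intro x₀ hx₀
  apply ContMDiffAt.contMDiffWithinAt
  rw [Bundle.contMDiffAt_section]
  set e := trivializationAt E (TangentSpace 𝓘(ℝ, E) : M → Type _) x₀
  have hx₀e : x₀ ∈ e.baseSet := mem_baseSet_trivializationAt E _ x₀
  have hnhds := e.open_baseSet.mem_nhds hx₀e
  have (x : M) : T2Space (TangentSpace 𝓘(ℝ, E) x) := inferInstanceAs (T2Space E)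
  have (x : M) : FiniteDimensional ℝ (TangentSpace 𝓘(ℝ, E) x) :=
    inferInstanceAs (FiniteDimensional ℝ E)
  -- `L` is the coframe in the tangent trivialization; the dual frame is given by its inverse.
  let L : M → E →L[ℝ] (Fin n → ℝ) := fun x =>
    (Θ x).toContinuousLinearEquiv.toContinuousLinearMap.comp (e.symmL ℝ x)
  have hL : ContMDiffAt 𝓘(ℝ, E) 𝓘(ℝ, E →L[ℝ] (Fin n → ℝ)) ∞ L x₀ := by
    refine contMDiffAt_clm_of_apply fun v => ?_
    rw [contMDiffAt_pi_space]
    intro i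
    have h1 := (contMDiffAt_hom_bundle _).1 ((hξ i).contMDiffAt (hU.mem_nhds hx₀))
    refine (h1.2.clm_apply (contMDiffAt_const (c := v))).congr_of_eventuallyEq ?_
    filter_upwards [hU.mem_nhds hx₀] with x hx
    have : L x v i = Θ x (e.symmL ℝ x v) i := rfl
    rw [this, hΘ x hx]
    simp [ContinuousLinearMap.inCoordinates]
    rfl
  have hLe : ∀ x (hx : x ∈ e.baseSet), L x = ((e.continuousLinearEquivAt ℝ x hx).symm.trans
      (Θ x).toContinuousLinearEquiv : E ≃L[ℝ] (Fin n → ℝ)) := by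
    intro x hx
    ext v
    simp [L, e.symmL_apply hx]
  have := (contMDiffAt_clm_inverse _ (hLe x₀ hx₀e) hL).clm_apply (contMDiffAt_const (c := w))
  refine this.congr_of_eventuallyEq ?_
  filter_upwards [hnhds] with x hx
  rw [hLe x hx, ContinuousLinearMap.inverse_equiv]
  simp

end Coframes

/-! ### Smooth sections of principal bundles with structure group `Spinᵒ` -/

section Sections

variable {E : Type*} [NormedAddCommGroup E] [NormedSpace ℝ E]
  {M : Type u} [TopologicalSpace M] [ChartedSpace E M]

/-- A smooth combination of smooth sections is smooth. -/
theorem contMDiffOn_apply_smoothVec {F : Type*} [NormedAddCommGroup F] [NormedSpace ℝ F]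
    {B : M → Type*} [TopologicalSpace (TotalSpace F B)]
    [∀ x, AddCommGroup (B x)] [∀ x, Module ℝ (B x)] [∀ x, TopologicalSpace (B x)]
    [FiberBundle F B] [VectorBundle ℝ F B]
    {W : Type*} [AddCommGroup W] [Module ℝ W] [FiniteDimensional ℝ W] {U : Set M}
    {L : ∀ x, W →ₗ[ℝ] B x} {c : M → W} (hL : ∀ w, ContMDiffOn 𝓘(ℝ, E) (𝓘(ℝ, E).prod 𝓘(ℝ, F)) ∞
      (fun x => TotalSpace.mk' F x (L x w)) U) (hc : SmoothVec E c U) :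
    ContMDiffOn 𝓘(ℝ, E) (𝓘(ℝ, E).prod 𝓘(ℝ, F)) ∞ (fun x => TotalSpace.mk' F x (L x (c x))) U := by
  let b := Module.finBasis ℝ W
  have key : ∀ x, L x (c x) = ∑ i, b.coord i (c x) • L x (b i) := fun x => by
    conv_lhs => rw [← b.sum_repr (c x), map_sum]
    simp
  simp only [key]
  exact ContMDiffOn.sum_section fun i _ => (hc _).smul_section (hL (b i))

theorem contMDiffOn_of_local {N : Type*} [TopologicalSpace N] {H : Type*} [TopologicalSpace H]
    [ChartedSpace H N] {E' : Type*} [NormedAddCommGroup E'] [NormedSpace ℝ E']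
    {I : ModelWithCorners ℝ E' H} {U : Set M} {f : M → N}
    (hf : ∀ x ∈ U, ∃ O, IsOpen O ∧ x ∈ O ∧ ContMDiffOn 𝓘(ℝ, E) I ∞ f (U ∩ O)) :
    ContMDiffOn 𝓘(ℝ, E) I ∞ f U := by
  intro x hx
  obtain ⟨O, hO, hxO, h⟩ := hf x hx
  exact (contMDiffWithinAt_inter (hO.mem_nhds hxO)).1 (h x ⟨hx, hxO⟩)

variable {V : Type*} [AddCommGroup V] [Module ℝ V] {h : QuadraticForm ℝ V} {α : ℝ}
  {P : PrincipalBundle.{u, _, w} M (SpinOGroup h α) (SmoothSpinO E h α)} {U U' : Set M}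
  {σ σ' : ∀ x, P.Fib x}

/-- This is a section by pure choice, without any continuity. It serves constructions that do not
depend on the point chosen in the fibre, and pointwise dimension counts. -/
theorem PrincipalBundle.nonempty_sections {M : Type*} [TopologicalSpace M] {G : Type*} [Group G]
    {Sm : (M → G) → Set M → Prop} (P : PrincipalBundle M G Sm) : Nonempty (∀ x, P.Fib x) :=
  ⟨fun x => (P.cover x).choose.2 x⟩

theorem isSmoothSection_of_mem_atlas {s : Set M × (∀ x, P.Fib x)} (hs : s ∈ P.atlas) :
    P.IsSmoothSection s.1 s.2 := fun t ht => by
  obtain ⟨f, hf, hsm⟩ := P.smooth_transition t ht s hs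
  rw [inter_comm] at hf hsm
  exact ⟨f, hf, hsm⟩

theorem IsSmoothSection.mono (hσ : P.IsSmoothSection U σ) (hU : U' ⊆ U) :
    P.IsSmoothSection U' σ := fun t ht => by
  obtain ⟨f, hf, hsm⟩ := hσ t ht
  exact ⟨f, fun x hx => hf x ⟨hU hx.1, hx.2⟩, hsm.mono (inter_subset_inter_left _ hU)⟩

theorem IsSmoothSection.act [FiniteDimensional ℝ V] (hσ : P.IsSmoothSection U σ)
    {f : M → SpinOGroup h α} (hf : SmoothSpinO E h α f U) :
    P.IsSmoothSection U (fun x => P.act (σ x) (f x)) := fun t ht => by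
  obtain ⟨f', hf', hsm⟩ := hσ t ht
  exact ⟨fun x => f' x * f x, fun x hx => by
      change P.act (σ x) (f x) = _
      rw [hf' x hx, P.act_mul],
    hsm.mul (hf.mono inter_subset_left)⟩

/-- Relative to an atlas section both sections have smooth coordinates `f₁` and `f₂`, and freeness
of the action gives `f = f₁⁻¹ f₂`. -/
theorem IsSmoothSection.transition [FiniteDimensional ℝ V] (hσ : P.IsSmoothSection U σ)
    (hσ' : P.IsSmoothSection U' σ') {f : M → SpinOGroup h α}
    (hf : ∀ x ∈ U ∩ U', σ' x = P.act (σ x) (f x)) : SmoothSpinO E h α f (U ∩ U') := by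
  refine SmoothSpinO.of_local fun x hx => ?_
  obtain ⟨t, ht, hxt⟩ := P.cover x
  obtain ⟨f₁, hf₁, hs₁⟩ := hσ t ht
  obtain ⟨f₂, hf₂, hs₂⟩ := hσ' t ht
  have h1 : t.1 ∩ (U ∩ U') ⊆ U ∩ t.1 := fun y hy => ⟨hy.2.1, hy.1⟩
  have h2 : t.1 ∩ (U ∩ U') ⊆ U' ∩ t.1 := fun y hy => ⟨hy.2.2, hy.1⟩
  refine ⟨t.1, P.isOpen_atlas t ht, hxt,
    ((hs₁.mono h1).inv.mul (hs₂.mono h2)).congr fun y hy => ?_⟩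
  have e := hf y hy.2
  rw [hf₁ y (h1 hy), hf₂ y (h2 hy), ← P.act_mul] at e
  have := (P.existsUnique_act (t.2 y) (P.act (t.2 y) (f₂ y))).unique rfl e.symm
  rw [this, inv_mul_cancel_left]

end Sections

/-! ### The bundles `Σ`, `A` and `Σ ⊕ A` seen from a point of `Q` -/

section Associated

variable {E : Type*} [NormedAddCommGroup E] [NormedSpace ℝ E] [FiniteDimensional ℝ E]
  {M : Type u} [TopologicalSpace M] [ChartedSpace E M] [IsManifold 𝓘(ℝ, E) ∞ M] {p q : ℕ}
  {g : PseudoRiemannianMetric E M p q}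
  {V : Type*} [AddCommGroup V] [Module ℝ V] {h : QuadraticForm ℝ V} {α : ℝ}

/-- Equivariance passes smoothness from the atlas sections to every smooth section, because the
representation of a smooth family is smooth. -/
theorem SpinOStructure.smoothCovector_Lam [FiniteDimensional ℝ V]
    (𝒬 : SpinOStructure.{u, w} g h α) {U : Set M} {σ : ∀ x, 𝒬.Q.Fib x}
    (hσ : 𝒬.Q.IsSmoothSection U σ) (v : V) :
    SmoothCovector E (fun x => 𝒬.Lam x (σ x) v) U := by
  refine contMDiffOn_of_local fun x hx => ?_
  obtain ⟨t, ht, hxt⟩ := 𝒬.Q.cover x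
  obtain ⟨f, hf, hs⟩ := hσ t ht
  refine ⟨t.1, 𝒬.Q.isOpen_atlas t ht, hxt, ?_⟩
  have := contMDiffOn_apply_smoothVec (F := E →L[ℝ] ℝ) (B := fun x : M => CotangentSpace E x)
    (L := fun x => (𝒬.Lam x (t.2 x)).toLinearEquiv.toLinearMap)
    (fun w => ContMDiffOn.mono (𝒬.smooth t ht w) inter_subset_right)
    (hs.smoothVec_twistedVectorRep v)
  refine this.congr fun y hy => ?_
  change TotalSpace.mk' _ y (𝒬.Lam y (σ y) v) = _
  rw [hf y hy, 𝒬.equivariant]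
  rfl

variable {S₀ : Type*} [NormedAddCommGroup S₀] [NormedSpace ℝ S₀]
  {S : M → Type*} [TopologicalSpace (TotalSpace S₀ S)]
  [∀ x, AddCommGroup (S x)] [∀ x, Module ℝ (S x)] [∀ x, TopologicalSpace (S x)]
  [∀ x, IsTopologicalAddGroup (S x)] [∀ x, ContinuousSMul ℝ (S x)]
  [FiberBundle S₀ S] [VectorBundle ℝ S₀ S]
  {γ₀ : CliffordAlgebra h →ₐ[ℝ] (S₀ →L[ℝ] S₀)}
  {γ₂ : CliffordAlgebra (planeForm α) →ₐ[ℝ] (S₀ →L[ℝ] S₀)}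
  {𝒮 : ElementaryPinor S₀ S g} {𝒬 : SpinOStructure.{u, w} g h α}

theorem AssociatedIso.contMDiffOn_frame [FiniteDimensional ℝ S₀] (u : AssociatedIso 𝒬 𝒮 γ₀ γ₂) {U : Set M}
    {σ : ∀ x, 𝒬.Q.Fib x} (hσ : 𝒬.Q.IsSmoothSection U σ) (s : S₀) :
    ContMDiffOn 𝓘(ℝ, E) (𝓘(ℝ, E).prod 𝓘(ℝ, S₀)) ∞
      (fun x => TotalSpace.mk' S₀ x (u.frame x (σ x) s)) U := by
  refine contMDiffOn_of_local fun x hx => ?_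
  obtain ⟨t, ht, hxt⟩ := 𝒬.Q.cover x
  obtain ⟨f, hf, hs⟩ := hσ t ht
  refine ⟨t.1, 𝒬.Q.isOpen_atlas t ht, hxt, ?_⟩
  have := contMDiffOn_apply_smoothVec
    (L := fun x => (u.frame x (t.2 x)).toLinearEquiv.toLinearMap)
    (fun w => ContMDiffOn.mono (u.smooth t ht w) inter_subset_right)
    (hs.smoothVec_twistedRep γ₀ γ₂ s)
  refine this.congr fun y hy => ?_
  change TotalSpace.mk' _ y (u.frame y (σ y) s) = _
  rw [hf y hy, u.equivariant]
  rfl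

/-- The action of `Cl₂(α)` on the fibre of `S` defined by a point of `Q`. -/
def AssociatedIso.twist (u : AssociatedIso 𝒬 𝒮 γ₀ γ₂) (x : M) (z : 𝒬.Q.Fib x) :
    CliffordAlgebra (planeForm α) →ₐ[ℝ] (S x →L[ℝ] S x) :=
  (conjEnd (u.frame x z)).toAlgHom.comp γ₂

theorem AssociatedIso.twist_apply (u : AssociatedIso 𝒬 𝒮 γ₀ γ₂) (x : M) (z : 𝒬.Q.Fib x)
    (c : CliffordAlgebra (planeForm α)) : u.twist x z c = conjEnd (u.frame x z) (γ₂ c) := rfl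

theorem AssociatedIso.twist_injective (u : AssociatedIso 𝒬 𝒮 γ₀ γ₂) (hd : TwistData γ₀ γ₂) (x : M)
    (z : 𝒬.Q.Fib x) : Function.Injective (u.twist x z) :=
  (conjEnd (u.frame x z)).injective.comp hd.injective

/-- The frame changes by `γ₀(a) γ₂(b)`. Since `a` is even, `γ₀(a)` commutes with the image of `γ₂`,
and only conjugation by `b` remains. -/
theorem AssociatedIso.twist_act (u : AssociatedIso 𝒬 𝒮 γ₀ γ₂) (hd : TwistData γ₀ γ₂) (x : M)
    (z : 𝒬.Q.Fib x) (a : Spin h) (b : Pin (planeForm α)) (c : CliffordAlgebra (planeForm α)) :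
    u.twist x (𝒬.Q.act z (SpinOGroup.mk h α a b)) c
      = u.twist x z ((b : (CliffordAlgebra (planeForm α))ˣ) * c *
        ((b : (CliffordAlgebra (planeForm α))ˣ)⁻¹ : (CliffordAlgebra (planeForm α))ˣ)) := by
  set a' : CliffordAlgebra h := ((a : (CliffordAlgebra h)ˣ) : CliffordAlgebra h)
  set b' := (b : (CliffordAlgebra (planeForm α))ˣ)
  ext s
  obtain ⟨s, rfl⟩ := (u.frame x (𝒬.Q.act z (SpinOGroup.mk h α a b))).surjective s
  have key : γ₂ (b' * c * (b'⁻¹ : (CliffordAlgebra (planeForm α))ˣ)) * (γ₀ a' * γ₂ b')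
      = (γ₀ a' * γ₂ b') * γ₂ c := by
    rw [← mul_assoc, hd.commute_even _ a.2.2, mul_assoc (γ₀ _), mul_assoc (γ₀ _),
      ← map_mul γ₂, ← map_mul γ₂, Units.inv_mul_cancel_right]
  rw [u.twist_apply, conjEnd_apply, ContinuousLinearEquiv.symm_apply_apply, u.equivariant,
    u.equivariant, u.twist_apply, conjEnd_apply, ContinuousLinearEquiv.symm_apply_apply]
  exact congrArg (fun L : S₀ →L[ℝ] S₀ => u.frame x z (L s)) key.symm

theorem AssociatedIso.twist_act_spin (u : AssociatedIso 𝒬 𝒮 γ₀ γ₂) (hd : TwistData γ₀ γ₂) (x : M)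
    (z : 𝒬.Q.Fib x) (a : Spin h) (c : CliffordAlgebra (planeForm α)) :
    u.twist x (𝒬.Q.act z (spinInclusion h α a)) c = u.twist x z c := by
  have h1 := u.twist_act hd x z a 1 c
  simp only [OneMemClass.coe_one, Units.val_one, inv_one, one_mul, mul_one] at h1
  exact h1

theorem AssociatedIso.γ_ι_Lam (u : AssociatedIso 𝒬 𝒮 γ₀ γ₂) (x : M) (z : 𝒬.Q.Fib x) (v : V) :
    𝒮.γ x (CliffordAlgebra.ι (g.dualForm x) (𝒬.Lam x z v))
      = conjEnd (u.frame x z) (γ₀ (CliffordAlgebra.ι h v)) := by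
  ext s
  obtain ⟨s, rfl⟩ := (u.frame x z).surjective s
  rw [u.clifford, conjEnd_apply, ContinuousLinearEquiv.symm_apply_apply]

/-- The coframe at `z` is onto, so conditions over all covectors can be tested on the model. The
arbitrary predicate `R` covers both commuting and anticommuting. -/
theorem AssociatedIso.forall_covector_iff (u : AssociatedIso 𝒬 𝒮 γ₀ γ₂) (x : M) (z : 𝒬.Q.Fib x)
    {R : (S x →L[ℝ] S x) → Prop} :
    (∀ ξ : CotangentSpace E x, R (𝒮.γ x (CliffordAlgebra.ι (g.dualForm x) ξ))) ↔
      ∀ v : V, R (conjEnd (u.frame x z) (γ₀ (CliffordAlgebra.ι h v))) := by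
  simp only [← u.γ_ι_Lam]
  exact ⟨fun H v => H _, fun H ξ => by
    obtain ⟨v, rfl⟩ := (𝒬.Lam x z).toLinearEquiv.surjective ξ
    exact H v⟩

theorem AssociatedIso.mem_schurBundle_iff (u : AssociatedIso 𝒬 𝒮 γ₀ γ₂) (hd : TwistData γ₀ γ₂)
    (x : M) (z : 𝒬.Q.Fib x) (T : S x →L[ℝ] S x) :
    T ∈ schurBundle 𝒮 x ↔ ∃ a d : ℝ, T = u.twist x z (planeElt α a 0 0 d) := by
  obtain ⟨T, rfl⟩ := (conjEnd (u.frame x z)).surjective T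
  have h1 : conjEnd (u.frame x z) T ∈ schurBundle 𝒮 x ↔ _ :=
    u.forall_covector_iff x z (R := fun X => conjEnd (u.frame x z) T * X
      = X * conjEnd (u.frame x z) T)
  rw [h1]
  simp only [← map_mul, EmbeddingLike.apply_eq_iff_eq, u.twist_apply]
  exact hd.commute_iff T

theorem AssociatedIso.mem_anticommutantBundle_iff (u : AssociatedIso 𝒬 𝒮 γ₀ γ₂)
    (hd : TwistData γ₀ γ₂) (x : M) (z : 𝒬.Q.Fib x) (T : S x →L[ℝ] S x) :
    T ∈ anticommutantBundle 𝒮 x ↔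
      ∃ w, T = u.twist x z (CliffordAlgebra.ι (planeForm α) w) := by
  obtain ⟨T, rfl⟩ := (conjEnd (u.frame x z)).surjective T
  have h1 : conjEnd (u.frame x z) T ∈ anticommutantBundle 𝒮 x ↔ _ :=
    u.forall_covector_iff x z (R := fun X => conjEnd (u.frame x z) T * X
      = -(X * conjEnd (u.frame x z) T))
  rw [h1]
  simp only [← map_mul, ← map_neg, EmbeddingLike.apply_eq_iff_eq, u.twist_apply]
  exact hd.anticommute_iff T

theorem AssociatedIso.smoothEnd_twist_iff [FiniteDimensional ℝ S₀] (u : AssociatedIso 𝒬 𝒮 γ₀ γ₂) {U : Set M}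
    (hU : IsOpen U) {σ : ∀ x, 𝒬.Q.Fib x} (hσ : 𝒬.Q.IsSmoothSection U σ)
    (c : M → CliffordAlgebra (planeForm α)) :
    SmoothEnd E S₀ (fun x => u.twist x (σ x) (c x)) U ↔ SmoothVec E (fun x => γ₂ (c x)) U :=
  smoothEnd_conjEnd_iff hU (φ := fun x => u.frame x (σ x)) (u.contMDiffOn_frame hσ) _

/-- The splitting of `Cl₂(α)` into even part and vectors corresponds to `Σ ⊕ A`. -/
theorem range_twist_eq_twistBundle (u : AssociatedIso 𝒬 𝒮 γ₀ γ₂) (hd : TwistData γ₀ γ₂) (x : M)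
    (z : 𝒬.Q.Fib x) : LinearMap.range (u.twist x z).toLinearMap = twistBundle 𝒮 x := by
  apply le_antisymm
  · rintro _ ⟨c, rfl⟩
    obtain ⟨a, b, c, d, rfl⟩ := exists_eq_planeElt c
    have e : planeElt α a b c d
        = planeElt α a 0 0 d + CliffordAlgebra.ι (planeForm α) ![b, c] := by
      rw [ι_eq_planeElt]
      simp only [planeElt, Matrix.cons_val_zero, Matrix.cons_val_one]
      module
    rw [e, AlgHom.toLinearMap_apply, map_add]
    exact Submodule.add_mem_sup ((u.mem_schurBundle_iff hd x z _).2 ⟨_, _, rfl⟩)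
      ((u.mem_anticommutantBundle_iff hd x z _).2 ⟨_, rfl⟩)
  · refine sup_le (fun T hT => ?_) (fun T hT => ?_)
    · obtain ⟨a, d, rfl⟩ := (u.mem_schurBundle_iff hd x z _).1 hT
      exact ⟨_, rfl⟩
    · obtain ⟨w, rfl⟩ := (u.mem_anticommutantBundle_iff hd x z _).1 hT
      exact ⟨_, rfl⟩

/-- The isomorphism of `ℝ²` with the fibre of the anticommutant bundle that a point of `Q`
defines. -/
def AssociatedIso.anticommutantEquiv (u : AssociatedIso 𝒬 𝒮 γ₀ γ₂) (hd : TwistData γ₀ γ₂) (x : M)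
    (z : 𝒬.Q.Fib x) : (Fin 2 → ℝ) ≃ₗ[ℝ] anticommutantBundle 𝒮 x :=
  LinearEquiv.ofBijective (LinearMap.codRestrict _
    ((u.twist x z).toLinearMap ∘ₗ CliffordAlgebra.ι (planeForm α))
    fun w => (u.mem_anticommutantBundle_iff hd x z _).2 ⟨w, rfl⟩) (by
      constructor
      · intro w w' hw
        exact ι_injective _ (u.twist_injective hd _ _ (congrArg Subtype.val hw))
      · rintro ⟨T, hT⟩
        obtain ⟨w, rfl⟩ := (u.mem_anticommutantBundle_iff hd x z _).1 hT
        exact ⟨w, rfl⟩)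

/-! ### Consequences of a reduction to `Spin` -/

/-- The arbitrary section `σ` may be replaced locally by an atlas section of `P'`: the two differ by
`Spin`, which does not change the action of `Cl₂(α)`. -/
theorem AssociatedIso.smoothEnd_twist_of_reduction [FiniteDimensional ℝ S₀] (u : AssociatedIso 𝒬 𝒮 γ₀ γ₂)
    (hd : TwistData γ₀ γ₂) {P' : PrincipalBundle.{u, _, w} M (Spin h) (SmoothSpin E h)}
    {F : ∀ x, P'.Fib x → 𝒬.Q.Fib x}
    (hF : ∀ (x : M) (q : P'.Fib x) (a : Spin h),
      F x (P'.act q a) = 𝒬.Q.act (F x q) (spinInclusion h α a))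
    (hFs : ∀ s ∈ P'.atlas, 𝒬.Q.IsSmoothSection s.1 (fun x => F x (s.2 x)))
    (σ : ∀ x, P'.Fib x) (c : CliffordAlgebra (planeForm α)) :
    SmoothEnd E S₀ (fun x => u.twist x (F x (σ x)) c) univ := by
  refine contMDiffOn_of_local fun x _ => ?_
  obtain ⟨s, hs, hxs⟩ := P'.cover x
  refine ⟨s.1, P'.isOpen_atlas s hs, hxs, ?_⟩
  rw [univ_inter]
  have := (u.smoothEnd_twist_iff (P'.isOpen_atlas s hs) (hFs s hs) (fun _ => c)).2
    (smoothVec_const _)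
  refine ContMDiffOn.congr this fun y _ => ?_
  obtain ⟨a, ha, -⟩ := P'.existsUnique_act (s.2 y) (σ y)
  change TotalSpace.mk' _ (E := fun x : M => S x →L[ℝ] S x) y (u.twist y (F y (σ y)) c) = _
  rw [← ha, hF, u.twist_act_spin hd]

theorem AssociatedIso.isTrivialAlgBundle_twistBundle [FiniteDimensional ℝ S₀] (u : AssociatedIso 𝒬 𝒮 γ₀ γ₂)
    (hd : TwistData γ₀ γ₂)
    (hr : 𝒬.Q.ReducesAlong (SmoothSpin E h) (spinInclusion h α)) :
    IsTrivialAlgBundle E S₀ (CliffordAlgebra (planeForm α)) (twistBundle 𝒮) := by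
  obtain ⟨P', F, hF, hFs⟩ := hr
  obtain ⟨σ⟩ := PrincipalBundle.nonempty_sections P'
  exact ⟨fun x => u.twist x (F x (σ x)), fun x => ⟨u.twist_injective hd _ _,
    range_twist_eq_twistBundle u hd _ _⟩, u.smoothEnd_twist_of_reduction hd hF hFs σ⟩

theorem AssociatedIso.isTrivialBundle_anticommutantBundle [FiniteDimensional ℝ S₀] (u : AssociatedIso 𝒬 𝒮 γ₀ γ₂)
    (hd : TwistData γ₀ γ₂)
    (hr : 𝒬.Q.ReducesAlong (SmoothSpin E h) (spinInclusion h α)) :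
    IsTrivialBundle E S₀ (anticommutantBundle 𝒮) := by
  obtain ⟨P', F, hF, hFs⟩ := hr
  obtain ⟨σ⟩ := PrincipalBundle.nonempty_sections P'
  exact ⟨2, fun x => u.anticommutantEquiv hd x (F x (σ x)),
    fun c => u.smoothEnd_twist_of_reduction hd hF hFs σ _⟩

theorem AssociatedIso.isTrivialAlgBundle_schurBundle [FiniteDimensional ℝ S₀] (u : AssociatedIso 𝒬 𝒮 γ₀ γ₂)
    (hα : α = 1 ∨ α = -1) (hd : TwistData γ₀ γ₂)
    (hr : 𝒬.Q.ReducesAlong (SmoothSpin E h) (spinInclusion h α)) :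
    IsTrivialAlgBundle E S₀ ℂ (schurBundle 𝒮) := by
  obtain ⟨P', F, hF, hFs⟩ := hr
  obtain ⟨σ⟩ := PrincipalBundle.nonempty_sections P'
  -- `(e₁e₂)² = -α² = -1` for both signs, so `i ↦ e₁e₂` embeds `ℂ` as the even part.
  have hJ : planeElt α 0 0 0 1 * planeElt α 0 0 0 1 = -1 := by
    rw [planeElt_mul, ← planeElt_one]
    rcases hα with rfl | rfl <;> simp [planeElt]
  let f : ℂ →ₐ[ℝ] CliffordAlgebra (planeForm α) := Complex.lift ⟨planeElt α 0 0 0 1, hJ⟩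
  have hf : ∀ z : ℂ, f z = planeElt α z.re 0 0 z.im := fun z => by
    simp [f, Complex.lift_apply, Complex.liftAux_apply, Algebra.algebraMap_eq_smul_one, planeElt]
  refine ⟨fun x => (u.twist x (F x (σ x))).comp f, fun x => ⟨?_, ?_⟩,
    fun c => u.smoothEnd_twist_of_reduction hd hF hFs σ _⟩
  · exact (u.twist_injective hd _ _).comp f.toRingHom.injective
  · ext T
    rw [u.mem_schurBundle_iff hd x (F x (σ x))]
    constructor
    · rintro ⟨z, rfl⟩
      exact ⟨z.re, z.im, by rw [← hf]; rfl⟩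
    · rintro ⟨a, d, rfl⟩
      exact ⟨⟨a, d⟩, by
        change u.twist x (F x (σ x)) (f ⟨a, d⟩) = _
        rw [hf]⟩

end Associated

/-! ### Orientability -/

section Orientability

variable {E : Type*} [NormedAddCommGroup E] [NormedSpace ℝ E] [FiniteDimensional ℝ E]
  {M : Type u} [TopologicalSpace M] [ChartedSpace E M] [IsManifold 𝓘(ℝ, E) ∞ M] {p q : ℕ}
  {g : PseudoRiemannianMetric E M p q}
  {V : Type*} [AddCommGroup V] [Module ℝ V] {h : QuadraticForm ℝ V} {α : ℝ}

instance finiteDimensional_tangentSpace (x : M) :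
    FiniteDimensional ℝ (TangentSpace 𝓘(ℝ, E) x) :=
  inferInstanceAs (FiniteDimensional ℝ E)

theorem SpinOStructure.finrank_eq (𝒬 : SpinOStructure.{u, w} g h α) (x : M) :
    Module.finrank ℝ V = Module.finrank ℝ E := by
  obtain ⟨σ⟩ := 𝒬.Q.nonempty_sections
  have h1 := ((𝒬.Lam x (σ x)).toLinearEquiv.trans (g.flat x).symm).finrank_eq
  exact h1

theorem eq_zero_of_forall_covector {E : Type*} [NormedAddCommGroup E] [NormedSpace ℝ E]
    [FiniteDimensional ℝ E] {M : Type*} [TopologicalSpace M] [ChartedSpace E M] {x : M} {v : TangentSpace 𝓘(ℝ, E) x}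
    (hv : ∀ ξ : CotangentSpace E x, ξ v = 0) : v = 0 := by
  have h1 : ∀ l : Module.Dual ℝ E, l v = 0 := fun l => by
    have := hv (LinearMap.toContinuousLinearMap (E := E) l : E →L[ℝ] ℝ)
    exact this
  exact (Module.forall_dual_apply_eq_zero_iff ℝ (V := E) v).1 h1

/-- The isomorphism of the tangent space with `ℝⁿ` given by the coframe that a point of `Q` and a
basis of `V` define. -/
def SpinOStructure.coframe (𝒬 : SpinOStructure.{u, w} g h α)
    (b : Module.Basis (Fin (Module.finrank ℝ E)) ℝ V) (x : M) (z : 𝒬.Q.Fib x) :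
    TangentSpace 𝓘(ℝ, E) x ≃ₗ[ℝ] (Fin (Module.finrank ℝ E) → ℝ) :=
  LinearMap.linearEquivOfInjective
    (LinearMap.pi fun i => (𝒬.Lam x z (b i) : TangentSpace 𝓘(ℝ, E) x →ₗ[ℝ] ℝ)) (by
      rw [injective_iff_map_eq_zero]
      intro v hv
      refine eq_zero_of_forall_covector fun ξ => ?_
      obtain ⟨w, rfl⟩ := (𝒬.Lam x z).toLinearEquiv.surjective ξ
      rw [← b.sum_repr w]
      simp only [map_sum, map_smul]
      have h1 : ∀ i, (𝒬.Lam x z).toLinearEquiv (b i) v = 0 := fun i => congrFun hv i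
      rw [sum_apply]
      exact Finset.sum_eq_zero fun i _ => by
        rw [smul_apply, h1, smul_zero])
    (by rw [Module.finrank_fin_fun]; rfl)

theorem SpinOStructure.coframe_apply (𝒬 : SpinOStructure.{u, w} g h α)
    (b : Module.Basis (Fin (Module.finrank ℝ E)) ℝ V) (x : M) (z : 𝒬.Q.Fib x)
    (v : TangentSpace 𝓘(ℝ, E) x) (i : Fin (Module.finrank ℝ E)) :
    𝒬.coframe b x z v i = 𝒬.Lam x z (b i) v := rfl

theorem twistedVectorRep_spinInclusion (a : Spin h) (v : V) :
    twistedVectorRep h α (spinInclusion h α a) v = Ad₀ h (a : (CliffordAlgebra h)ˣ) v := by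
  have h1 : twistedVectorRep h α (spinInclusion h α a)
      = LinearMap.det (Ad₀ (planeForm α) 1) • Ad₀ h (a : (CliffordAlgebra h)ˣ) := rfl
  rw [h1, Ad₀_one, LinearMap.det_id, one_smul]

/-- On `Spin` the twisted vector representation is `Ad₀`, of determinant one in odd dimension. The
frames dual to the coframes differ by the transpose of its matrix. -/
theorem SpinOStructure.orientation_coframe_act [FiniteDimensional ℝ V]
    (𝒬 : SpinOStructure.{u, w} g h α) (hodd : Odd (Module.finrank ℝ V))
    (b : Module.Basis (Fin (Module.finrank ℝ E)) ℝ V) (x : M) (z : 𝒬.Q.Fib x) (a : Spin h) :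
    (Module.Basis.ofEquivFun (𝒬.coframe b x (𝒬.Q.act z (spinInclusion h α a)))).orientation
      = (Module.Basis.ofEquivFun (𝒬.coframe b x z)).orientation := by
  rw [Module.Basis.orientation_eq_iff_det_pos, Module.Basis.det_apply]
  have key : (Module.Basis.ofEquivFun
      (𝒬.coframe b x (𝒬.Q.act z (spinInclusion h α a)))).toMatrix
        (Module.Basis.ofEquivFun (𝒬.coframe b x z))
      = (LinearMap.toMatrix b b (Ad₀ h (a : (CliffordAlgebra h)ˣ))).transpose := by
    ext i j
    have h1 : 𝒬.coframe b x (𝒬.Q.act z (spinInclusion h α a))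
        ((Module.Basis.ofEquivFun (𝒬.coframe b x z)) j) i
        = b.repr (Ad₀ h (a : (CliffordAlgebra h)ˣ) (b i)) j := by
      rw [𝒬.coframe_apply, 𝒬.equivariant, twistedVectorRep_spinInclusion]
      conv_lhs => rw [← b.sum_repr (Ad₀ h (a : (CliffordAlgebra h)ˣ) (b i))]
      have h2 : ∀ k, (𝒬.Lam x z) (b k) ((Module.Basis.ofEquivFun (𝒬.coframe b x z)) j)
          = (Pi.single j 1 : Fin (Module.finrank ℝ E) → ℝ) k := fun k => by
        rw [← 𝒬.coframe_apply, Module.Basis.coe_ofEquivFun, LinearEquiv.apply_symm_apply]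
      have h3 : ∀ w, (𝒬.Lam x z) w = (𝒬.Lam x z).toLinearEquiv w := fun _ => rfl
      rw [h3, map_sum, sum_apply]
      simp only [map_smul, smul_apply, ← h3, h2]
      simp [Pi.single_apply]
    rw [Matrix.transpose_apply, LinearMap.toMatrix_apply, ← h1]
    rfl
  rw [key, Matrix.det_transpose, LinearMap.det_toMatrix, det_Ad₀_of_odd h hodd a.2.1.1]
  exact one_pos

/-- All points of `P'` over `x` induce the same orientation, so an arbitrary section defines it and
the smooth atlas sections supply positively oriented local frames. -/
theorem SpinOStructure.isOrientable [FiniteDimensional ℝ V] [Nonempty M]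
    (𝒬 : SpinOStructure.{u, w} g h α) (hodd : Odd (Module.finrank ℝ V))
    (hr : 𝒬.Q.ReducesAlong (SmoothSpin E h) (spinInclusion h α)) : IsOrientable E M := by
  obtain ⟨P', F, hF, hFs⟩ := hr
  obtain ⟨σ⟩ := P'.nonempty_sections
  have x₁ : M := Classical.arbitrary M
  let b : Module.Basis (Fin (Module.finrank ℝ E)) ℝ V :=
    (Module.finBasis ℝ V).reindex (finCongr (𝒬.finrank_eq x₁))
  refine ⟨fun x => (Module.Basis.ofEquivFun (𝒬.coframe b x (F x (σ x)))).orientation,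
    fun x₀ => ?_⟩
  obtain ⟨s, hs, hxs⟩ := P'.cover x₀
  let B : ∀ x, Module.Basis (Fin (Module.finrank ℝ E)) ℝ (TangentSpace 𝓘(ℝ, E) x) :=
    fun x => Module.Basis.ofEquivFun (𝒬.coframe b x (F x (s.2 x)))
  have he : IsLocalFrameOn 𝓘(ℝ, E) E ∞ (fun i x => B x i) s.1 :=
    { linearIndependent := fun {x} _ => (B x).linearIndependent
      generating := fun {x} _ => (B x).span_eq.ge
      contMDiffOn := fun i => by
        simp only [B, Module.Basis.coe_ofEquivFun]
        exact contMDiffOn_dualFrame (P'.isOpen_atlas s hs)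
          (fun i => 𝒬.smoothCovector_Lam (hFs s hs) (b i)) _ (fun x _ v i => rfl) _ }
  refine ⟨s.1, fun i x => B x i, he, P'.isOpen_atlas s hs, hxs, fun x hx => ?_⟩
  have hB : he.toBasisAt hx = B x := by
    ext i
    simp
  obtain ⟨a, ha, -⟩ := P'.existsUnique_act (s.2 x) (σ x)
  change _ = (Module.Basis.ofEquivFun (𝒬.coframe b x (F x (σ x)))).orientation
  rw [hB, ← ha, hF, 𝒬.orientation_coframe_act hodd]

end Orientability

/-! ### Half angles -/

section HalfAngle

/-- The bisector of the positive axis and `(a, b)` has direction `(R + a, b)`, where `R` is the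
modulus. Its squared length is `2R(R + a)`, nonzero off the closed negative axis. -/
theorem exists_halfAngle_of_pos {a₀ b₀ : ℝ} (h₀ : 0 < √(a₀ ^ 2 + b₀ ^ 2) + a₀) :
    ∃ X Y : ℝ × ℝ → ℝ, ∀ᶠ p in 𝓝 (a₀, b₀), (ContDiffAt ℝ ∞ X p ∧ ContDiffAt ℝ ∞ Y p) ∧
      X p ^ 2 + Y p ^ 2 = 1 ∧ √(p.1 ^ 2 + p.2 ^ 2) * (X p ^ 2 - Y p ^ 2) = p.1 ∧
        √(p.1 ^ 2 + p.2 ^ 2) * (2 * X p * Y p) = p.2 := by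
  have hne : ∀ a b : ℝ, 0 < √(a ^ 2 + b ^ 2) + a → 0 < a ^ 2 + b ^ 2 := by
    intro a b hab
    by_contra hle
    have ha : a = 0 := by nlinarith [sq_nonneg a, sq_nonneg b]
    have hb : b = 0 := by nlinarith [sq_nonneg a, sq_nonneg b]
    subst ha hb
    simp at hab
  let R : ℝ × ℝ → ℝ := fun p => √(p.1 ^ 2 + p.2 ^ 2)
  let s : ℝ × ℝ → ℝ := fun p => √(2 * R p * (R p + p.1))
  refine ⟨fun p => (R p + p.1) / s p, fun p => p.2 / s p, ?_⟩
  have hcont : Continuous fun p : ℝ × ℝ => R p + p.1 := by fun_prop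
  filter_upwards [(isOpen_lt continuous_const hcont).mem_nhds h₀] with p hp
  have hp' : 0 < R p + p.1 := hp
  have hRp : 0 < R p := Real.sqrt_pos.2 (hne _ _ hp')
  have hR2 : R p ^ 2 = p.1 ^ 2 + p.2 ^ 2 := Real.sq_sqrt (hne _ _ hp').le
  have hs2 : s p ^ 2 = 2 * R p * (R p + p.1) :=
    Real.sq_sqrt (mul_pos (mul_pos two_pos hRp) hp').le
  have hsp : s p ≠ 0 := (Real.sqrt_pos.2 (mul_pos (mul_pos two_pos hRp) hp')).ne'
  have hR : ContDiffAt ℝ ∞ R p := ContDiffAt.sqrt (by fun_prop) (hne _ _ hp').ne'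
  have hs : ContDiffAt ℝ ∞ s p :=
    ContDiffAt.sqrt ((contDiffAt_const.mul hR).mul (hR.add contDiffAt_fst))
      (mul_pos (mul_pos two_pos hRp) hp').ne'
  refine ⟨⟨(hR.add contDiffAt_fst).div hs hsp, contDiffAt_snd.div hs hsp⟩, ?_⟩
  change _ ∧ R p * _ = _ ∧ R p * _ = _
  refine ⟨?_, ?_, ?_⟩
  · rw [div_pow, div_pow, ← add_div, div_eq_one_iff_eq (pow_ne_zero 2 hsp)]
    linear_combination -hs2 - hR2
  · rw [div_pow, div_pow, ← sub_div, mul_div_assoc', div_eq_iff (pow_ne_zero 2 hsp)]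
    linear_combination -p.1 * hs2 + R p * hR2
  · have e : R p * (2 * ((R p + p.1) / s p) * (p.2 / s p))
        = (2 * R p * (R p + p.1)) * p.2 / s p ^ 2 := by field_simp
    rw [e, ← hs2, mul_div_assoc, mul_div_cancel₀]
    exact pow_ne_zero 2 hsp

/-- On the negative axis, apply the previous formula to `(-a, b)` and swap `X` with `Y`: this
negates `X² - Y²` and keeps `2XY`. -/
theorem exists_halfAngle {a₀ b₀ : ℝ} (h₀ : 0 < a₀ ^ 2 + b₀ ^ 2) :
    ∃ X Y : ℝ × ℝ → ℝ, ∀ᶠ p in 𝓝 (a₀, b₀), (ContDiffAt ℝ ∞ X p ∧ ContDiffAt ℝ ∞ Y p) ∧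
      X p ^ 2 + Y p ^ 2 = 1 ∧ √(p.1 ^ 2 + p.2 ^ 2) * (X p ^ 2 - Y p ^ 2) = p.1 ∧
        √(p.1 ^ 2 + p.2 ^ 2) * (2 * X p * Y p) = p.2 := by
  by_cases h : 0 < √(a₀ ^ 2 + b₀ ^ 2) + a₀
  · exact exists_halfAngle_of_pos h
  · have h' : 0 < √((-a₀) ^ 2 + b₀ ^ 2) + -a₀ := by
      rw [neg_sq]
      have := Real.sqrt_pos.2 h₀
      linarith
    obtain ⟨X, Y, hXY⟩ := exists_halfAngle_of_pos h'
    have hflip : ContDiff ℝ ∞ fun p : ℝ × ℝ => (-p.1, p.2) := by fun_prop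
    refine ⟨fun p => Y (-p.1, p.2), fun p => X (-p.1, p.2), ?_⟩
    have hev := (hflip.continuous.tendsto (a₀, b₀)).eventually hXY
    filter_upwards [hev] with p hp
    obtain ⟨⟨hX, hY⟩, h1, h2, h3⟩ := hp
    simp only [neg_sq] at h2 h3
    exact ⟨⟨ContDiffAt.comp p (g := Y) hY hflip.contDiffAt,
      ContDiffAt.comp p (g := X) hX hflip.contDiffAt⟩, by linarith, by linarith, by linarith⟩

end HalfAngle

/-! ### Reduction of the structure group along a frame of the anticommutant bundle -/

section Rotation

variable {α : ℝ}

/-- Conjugation by the spinor rotates vectors by twice the angle of `(X, Y)`; the factor `α` in the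
spinor makes the sense of rotation the same for both signs. -/
theorem planeElt_mul_rotation (hα : α = 1 ∨ α = -1) {X Y : ℝ} (hXY : X ^ 2 + Y ^ 2 = 1) (c d : ℝ) :
    planeElt α 0 (c * (X ^ 2 - Y ^ 2) - d * (2 * X * Y)) (c * (2 * X * Y) + d * (X ^ 2 - Y ^ 2)) 0 *
        planeElt α X 0 0 (-(α * Y))
      = planeElt α X 0 0 (-(α * Y)) * planeElt α 0 c d 0 := by
  have hα2 : α ^ 2 = 1 := by rcases hα with rfl | rfl <;> norm_num
  rw [planeElt_mul, planeElt_mul]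
  congr 1
  · ring
  · linear_combination (c * X - Y * d) * hXY + Y * (c * (2 * X * Y) + d * (X ^ 2 - Y ^ 2) + d) * hα2
  · linear_combination (d * X + Y * c) * hXY - Y * (c * (X ^ 2 - Y ^ 2) - d * (2 * X * Y) + c) * hα2
  · ring

/-- `ε` is the sign of `D`. For a negative sign `b = e₁` does the flip, since conjugation by `e₁`
fixes `e₁` and negates `e₂`. -/
theorem exists_flip (hα : α = 1 ∨ α = -1) {D : ℝ} (hD : D ≠ 0) :
    ∃ (ε : ℝ) (b : Pin (planeForm α)), ε * ε = 1 ∧ 0 < ε * D ∧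
      ∀ c d : ℝ, planeElt α 0 c (ε * d) 0 * (b : (CliffordAlgebra (planeForm α))ˣ)
        = (b : (CliffordAlgebra (planeForm α))ˣ) * planeElt α 0 c d 0 := by
  rcases lt_or_gt_of_ne hD with h | h
  · obtain ⟨b, hb⟩ := planeGen_zero_mem_Pin hα
    refine ⟨-1, b, by norm_num, by linarith, fun c d => ?_⟩
    rw [hb, planeGen_zero_eq, planeElt_mul, planeElt_mul]
    congr 1 <;> ring
  · exact ⟨1, 1, by norm_num, by linarith, fun c d => by simp⟩

end Rotation

/-! ### The adapted points of `Q` as a principal `Spin`-bundle -/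

section Reduction

variable {E : Type*} [NormedAddCommGroup E] [NormedSpace ℝ E] [FiniteDimensional ℝ E]
  {M : Type u} [TopologicalSpace M] [ChartedSpace E M] [IsManifold 𝓘(ℝ, E) ∞ M] {p q : ℕ}
  {g : PseudoRiemannianMetric E M p q}
  {V : Type*} [AddCommGroup V] [Module ℝ V] {h : QuadraticForm ℝ V} {α : ℝ}
  {S₀ : Type*} [NormedAddCommGroup S₀] [NormedSpace ℝ S₀]
  {S : M → Type*} [TopologicalSpace (TotalSpace S₀ S)]
  [∀ x, AddCommGroup (S x)] [∀ x, Module ℝ (S x)] [∀ x, TopologicalSpace (S x)]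
  [∀ x, IsTopologicalAddGroup (S x)] [∀ x, ContinuousSMul ℝ (S x)]
  [FiberBundle S₀ S] [VectorBundle ℝ S₀ S]
  {γ₀ : CliffordAlgebra h →ₐ[ℝ] (S₀ →L[ℝ] S₀)}
  {γ₂ : CliffordAlgebra (planeForm α) →ₐ[ℝ] (S₀ →L[ℝ] S₀)}
  {𝒮 : ElementaryPinor S₀ S g} {𝒬 : SpinOStructure.{u, w} g h α}

/-- The point `z` of `Q` is adapted to the pair `(T₁, T₂)` of endomorphisms if the latter arises
from `(e₁, e₂)` by an upper triangular matrix with positive diagonal. -/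
def AssociatedIso.IsAdapted (u : AssociatedIso 𝒬 𝒮 γ₀ γ₂) (T₁ T₂ : ∀ x, S x →L[ℝ] S x) (x : M)
    (z : 𝒬.Q.Fib x) : Prop :=
  ∃ r c d : ℝ, 0 < r ∧ 0 < d ∧ T₁ x = u.twist x z (r • planeGen α 0) ∧
    T₂ x = u.twist x z (c • planeGen α 0 + d • planeGen α 1)

variable {u : AssociatedIso 𝒬 𝒮 γ₀ γ₂} {T₁ T₂ : ∀ x, S x →L[ℝ] S x}

theorem IsAdapted.act (hd : TwistData γ₀ γ₂) {x : M} {z : 𝒬.Q.Fib x}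
    (hz : u.IsAdapted T₁ T₂ x z) (a : Spin h) :
    u.IsAdapted T₁ T₂ x (𝒬.Q.act z (spinInclusion h α a)) := by
  obtain ⟨r, c, d, hr, hd', h1, h2⟩ := hz
  exact ⟨r, c, d, hr, hd', by rw [u.twist_act_spin hd, h1], by rw [u.twist_act_spin hd, h2]⟩

/-- If `[a,b]` relates two adapted points, then conjugation by `b` is triangular with positive
diagonal, hence `b = ±1`. For `b = -1` the class equals `[-a,1]`. -/
theorem IsAdapted.exists_act_eq (hα : α = 1 ∨ α = -1) (hneg : (-1 : (CliffordAlgebra h)ˣ) ∈ Spin h)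
    (hd : TwistData γ₀ γ₂) {x : M} {z z' : 𝒬.Q.Fib x} (hz : u.IsAdapted T₁ T₂ x z)
    (hz' : u.IsAdapted T₁ T₂ x z') : ∃ a : Spin h, 𝒬.Q.act z (spinInclusion h α a) = z' := by
  obtain ⟨k, rfl, -⟩ := 𝒬.Q.existsUnique_act z z'
  obtain ⟨⟨a, b⟩, rfl⟩ := QuotientGroup.mk_surjective k
  obtain ⟨r, c, d, hr, hd₁, h1, h2⟩ := hz
  obtain ⟨r', c', d', hr', hd₁', h1', h2'⟩ := hz'
  have e1 := u.twist_act hd x z a b (r' • planeGen α 0)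
  have e2 := u.twist_act hd x z a b (c' • planeGen α 0 + d' • planeGen α 1)
  have hb := eq_one_or_neg_one_of_triangular hα b hr hd₁ hr' hd₁'
    (u.twist_injective hd x z (h1.symm.trans (h1'.trans e1)))
    (u.twist_injective hd x z (h2.symm.trans (h2'.trans e2)))
  rcases hb with hb | hb
  · exact ⟨a, congrArg _ ((spinInclusion_eq_mk_iff a a b).2 (Or.inl ⟨rfl, hb⟩))⟩
  · exact ⟨⟨-1, hneg⟩ * a, congrArg _ ((spinInclusion_eq_mk_iff _ a b).2
      (Or.inr ⟨by simp, hb⟩))⟩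

/-- Gram–Schmidt in spinor form: `β` is the lift of the rotation taking `e₁` to the direction of
`T₁`, times a constant flip that makes the second diagonal entry positive. -/
theorem exists_local_adapted [FiniteDimensional ℝ S₀] (hα : α = 1 ∨ α = -1) (hd : TwistData γ₀ γ₂)
    (hT₁ : ∀ x, T₁ x ∈ anticommutantBundle 𝒮 x) (hT₂ : ∀ x, T₂ x ∈ anticommutantBundle 𝒮 x)
    (hli : ∀ x (s t : ℝ), s • T₁ x + t • T₂ x = 0 → s = 0 ∧ t = 0)
    (hs₁ : SmoothEnd E S₀ T₁ univ) (hs₂ : SmoothEnd E S₀ T₂ univ)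
    {t : Set M × (∀ x, 𝒬.Q.Fib x)} (ht : t ∈ 𝒬.Q.atlas) {x₀ : M} (hx₀ : x₀ ∈ t.1) :
    ∃ (O : Set M) (β : M → Pin (planeForm α)), IsOpen O ∧ x₀ ∈ O ∧ O ⊆ t.1 ∧
      SmoothPin E (planeForm α) β O ∧
      ∀ y ∈ O, u.IsAdapted T₁ T₂ y (𝒬.Q.act (t.2 y) (SpinOGroup.mk h α 1 (β y))) := by
  have ht1 := 𝒬.Q.isOpen_atlas t ht
  have hnhds : t.1 ∈ 𝓝 x₀ := ht1.mem_nhds hx₀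
  -- The linear left inverse recovers the coordinates of `T₁` and `T₂` smoothly from their matrices.
  obtain ⟨L, hL⟩ := (γ₂.toLinearMap ∘ₗ CliffordAlgebra.ι (planeForm α)).exists_leftInverse_of_injective
    (LinearMap.ker_eq_bot.2 (hd.injective.comp (ι_injective _)))
  have coords : ∀ T : ∀ x, S x →L[ℝ] S x, (∀ x, T x ∈ anticommutantBundle 𝒮 x) →
      SmoothEnd E S₀ T univ → ∃ w : M → Fin 2 → ℝ,
        (∀ y, T y = u.twist y (t.2 y) (CliffordAlgebra.ι (planeForm α) (w y))) ∧
        SmoothVec E w t.1 := by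
    intro T hT hs
    choose w hw using fun y => (u.mem_anticommutantBundle_iff hd y (t.2 y) (T y)).1 (hT y)
    refine ⟨w, hw, ?_⟩
    have h1 : SmoothEnd E S₀ (fun y => u.twist y (t.2 y) (CliffordAlgebra.ι (planeForm α) (w y)))
        t.1 := ContMDiffOn.congr (ContMDiffOn.mono hs (subset_univ _)) fun y _ =>
          congrArg (TotalSpace.mk' _ (E := fun x : M => S x →L[ℝ] S x) y) (hw y).symm
    have h2 := (u.smoothEnd_twist_iff ht1 (isSmoothSection_of_mem_atlas ht) _).1 h1
    refine (h2.linear L).congr fun y _ => ?_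
    exact (LinearMap.congr_fun hL (w y)).symm
  obtain ⟨w₁, hw₁, hsw₁⟩ := coords T₁ hT₁ hs₁
  obtain ⟨w₂, hw₂, hsw₂⟩ := coords T₂ hT₂ hs₂
  have hdet : ∀ y, w₁ y 0 * w₂ y 1 - w₁ y 1 * w₂ y 0 ≠ 0 := by
    intro y h0
    -- With zero determinant, the coefficient pairs `(w₂ 1, -w₁ 1)` and `(w₂ 0, -w₁ 0)` give
    -- relations; independence then forces `w₁ = 0`, itself a relation.
    have hrel : ∀ s r : ℝ, s • w₁ y + r • w₂ y = 0 → s = 0 ∧ r = 0 := fun s r hsr =>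
      hli y s r (by rw [hw₁, hw₂, ← map_smul, ← map_smul, ← map_smul, ← map_smul, ← map_add,
        ← map_add, hsr, map_zero, map_zero])
    have h1 := hrel (w₂ y 1) (-w₁ y 1) (by ext i; fin_cases i <;> simp <;> linarith)
    have h2 := hrel (w₂ y 0) (-w₁ y 0) (by ext i; fin_cases i <;> simp <;> linarith)
    have h3 := hrel 1 0 (by
      ext i
      fin_cases i
      · simpa using h2.2
      · simpa using h1.2)
    exact one_ne_zero h3.1
  have hpos : ∀ y, 0 < w₁ y 0 ^ 2 + w₁ y 1 ^ 2 := by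
    intro y
    by_contra hle
    have h0 : w₁ y 0 = 0 := by nlinarith [sq_nonneg (w₁ y 0), sq_nonneg (w₁ y 1)]
    have h1 : w₁ y 1 = 0 := by nlinarith [sq_nonneg (w₁ y 0), sq_nonneg (w₁ y 1)]
    exact hdet y (by rw [h0, h1]; ring)
  obtain ⟨X, Y, hXY⟩ := exists_halfAngle (hpos x₀)
  obtain ⟨ε, b₀, hεε, hε, hb₀⟩ := exists_flip hα (hdet x₀)
  have hc1 : ∀ y ∈ t.1, ∀ i, ContMDiffAt 𝓘(ℝ, E) 𝓘(ℝ, ℝ) ∞ (fun y => w₁ y i) y := fun y hy i =>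
    (hsw₁ (LinearMap.proj i)).contMDiffAt (ht1.mem_nhds hy)
  have hc2 : ∀ y ∈ t.1, ∀ i, ContMDiffAt 𝓘(ℝ, E) 𝓘(ℝ, ℝ) ∞ (fun y => w₂ y i) y := fun y hy i =>
    (hsw₂ (LinearMap.proj i)).contMDiffAt (ht1.mem_nhds hy)
  have hpair : ∀ y ∈ t.1, ContMDiffAt 𝓘(ℝ, E) 𝓘(ℝ, ℝ × ℝ) ∞ (fun y => (w₁ y 0, w₁ y 1)) y :=
    fun y hy => (hc1 y hy 0).prodMk_space (hc1 y hy 1)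
  have hdetc : ContinuousAt (fun y => ε * (w₁ y 0 * w₂ y 1 - w₁ y 1 * w₂ y 0)) x₀ :=
    continuousAt_const.mul (((hc1 x₀ hx₀ 0).continuousAt.mul (hc2 x₀ hx₀ 1).continuousAt).sub
      ((hc1 x₀ hx₀ 1).continuousAt.mul (hc2 x₀ hx₀ 0).continuousAt))
  have hdetpos : ∀ᶠ y in 𝓝 x₀, 0 < ε * (w₁ y 0 * w₂ y 1 - w₁ y 1 * w₂ y 0) :=
    hdetc.eventually (lt_mem_nhds hε)
  have hev := (hpair x₀ hx₀).continuousAt.eventually hXY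
  obtain ⟨O, hO, hOo, hxO⟩ := mem_nhds_iff.1
    (Filter.inter_mem hnhds (Filter.inter_mem hdetpos hev))
  choose B hB using fun y : {y // X (w₁ y 0, w₁ y 1) ^ 2 + Y (w₁ y 0, w₁ y 1) ^ 2 = 1} =>
    rotationSpinor_mem_Pin hα y.2
  classical
  -- The default `1` is used only off the normalization locus, which contains `O`. On `O` the
  -- Clifford element is prescribed, so choosing a representative in `Pin` cannot spoil smoothness.
  let β : M → Pin (planeForm α) := fun y =>
    (if hy : X (w₁ y 0, w₁ y 1) ^ 2 + Y (w₁ y 0, w₁ y 1) ^ 2 = 1 then B ⟨y, hy⟩ else 1) * b₀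
  have hβ : ∀ y ∈ O, ((β y : (CliffordAlgebra (planeForm α))ˣ) : CliffordAlgebra (planeForm α))
      = planeElt α (X (w₁ y 0, w₁ y 1)) 0 0 (-(α * Y (w₁ y 0, w₁ y 1))) *
        ((b₀ : (CliffordAlgebra (planeForm α))ˣ) : CliffordAlgebra (planeForm α)) := by
    intro y hy
    have hy' := (hO hy).2.2.2.1
    rw [← hB ⟨y, hy'⟩]
    simp only [β]
    rw [dif_pos hy']
    rfl
  refine ⟨O, β, hOo, hxO, fun y hy => (hO hy).1, ?_, fun y hy => ?_⟩
  · have hX'' : ContMDiffOn 𝓘(ℝ, E) 𝓘(ℝ, ℝ) ∞ (fun y => X (w₁ y 0, w₁ y 1)) O :=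
      fun y hy => ((hO hy).2.2.1.1.contMDiffAt.comp y (hpair y (hO hy).1)).contMDiffWithinAt
    have hY'' : ContMDiffOn 𝓘(ℝ, E) 𝓘(ℝ, ℝ) ∞ (fun y => Y (w₁ y 0, w₁ y 1)) O :=
      fun y hy => ((hO hy).2.2.1.2.contMDiffAt.comp y (hpair y (hO hy).1)).contMDiffWithinAt
    have h1 := ((smoothVec_const (1 : CliffordAlgebra (planeForm α))).smul hX'').add
      ((smoothVec_const (-(α • (planeGen α 0 * planeGen α 1)))).smul hY'')
    refine (h1.mul (smoothVec_const ((b₀ : (CliffordAlgebra (planeForm α))ˣ) :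
      CliffordAlgebra (planeForm α)))).congr fun y hy => ?_
    rw [hβ y hy]
    congr 1
    simp only [planeElt]
    module
  · obtain ⟨-, hdety, hXYy⟩ := hO hy
    obtain ⟨-, n1, n2, n3⟩ := hXYy
    have hdety' : 0 < ε * (w₁ y 0 * w₂ y 1 - w₁ y 1 * w₂ y 0) := hdety
    set x := X (w₁ y 0, w₁ y 1)
    set z := Y (w₁ y 0, w₁ y 1)
    set ρ := √((w₁ y 0, w₁ y 1).1 ^ 2 + (w₁ y 0, w₁ y 1).2 ^ 2) with hρ
    have hρpos : 0 < ρ := Real.sqrt_pos.2 (hpos y)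
    simp only at n2 n3
    have conj : ∀ c d : ℝ, u.twist y (𝒬.Q.act (t.2 y) (SpinOGroup.mk h α 1 (β y)))
        (planeElt α 0 c d 0) = u.twist y (t.2 y) (planeElt α 0
          (c * (x ^ 2 - z ^ 2) - (ε * d) * (2 * x * z))
          (c * (2 * x * z) + (ε * d) * (x ^ 2 - z ^ 2)) 0) := by
      intro c d
      rw [u.twist_act hd]
      congr 1
      rw [Units.mul_inv_eq_iff_eq_mul, hβ y hy, ← mul_assoc, planeElt_mul_rotation hα n1,
        mul_assoc, mul_assoc, hb₀]
    -- `c` and `d` are the coordinates of `w₂` in the rotated orthonormal frame; the flip turns `d`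
    -- into `ε * d`.
    set c := (x ^ 2 - z ^ 2) * w₂ y 0 + (2 * x * z) * w₂ y 1
    set d := (x ^ 2 - z ^ 2) * w₂ y 1 - (2 * x * z) * w₂ y 0
    have hsq : (x ^ 2 - z ^ 2) ^ 2 + (2 * x * z) ^ 2 = 1 := by
      linear_combination (x ^ 2 + z ^ 2 + 1) * n1
    refine ⟨ρ, c, ε * d, hρpos, ?_, ?_, ?_⟩
    -- A rotation preserves determinants, so `ρ * d` is the determinant of `(w₁, w₂)`, whose sign
    -- near `x₀` is `ε`.
    · have e : ρ * (ε * d) = ε * (w₁ y 0 * w₂ y 1 - w₁ y 1 * w₂ y 0) := by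
        rw [← n2, ← n3]; ring
      exact (mul_pos_iff_of_pos_left hρpos).1 (e ▸ hdety')
    · have e : ρ • planeGen α 0 = planeElt α 0 ρ 0 0 := by simp [planeElt]
      rw [e, conj, hw₁, ι_eq_planeElt]
      congr 2
      · linear_combination -n2
      · linear_combination -n3
    · have e : c • planeGen α 0 + (ε * d) • planeGen α 1 = planeElt α 0 c (ε * d) 0 := by
        simp [planeElt]
      have hεd : ε * (ε * d) = d := by rw [← mul_assoc, hεε, one_mul]
      rw [e, conj, hw₂, ι_eq_planeElt, hεd]
      congr 2
      · linear_combination -w₂ y 0 * hsq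
      · linear_combination -w₂ y 1 * hsq

/-- The reduced bundle is the set of adapted points of `Q`, with `Spin` acting through the inclusion
and the smooth structure inherited from `Q`. -/
theorem reducesAlong_of_frame [FiniteDimensional ℝ V] [FiniteDimensional ℝ S₀]
    (u : AssociatedIso 𝒬 𝒮 γ₀ γ₂) (hα : α = 1 ∨ α = -1)
    (hneg : (-1 : (CliffordAlgebra h)ˣ) ∈ Spin h) (hd : TwistData γ₀ γ₂)
    (hT₁ : ∀ x, T₁ x ∈ anticommutantBundle 𝒮 x) (hT₂ : ∀ x, T₂ x ∈ anticommutantBundle 𝒮 x)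
    (hli : ∀ x (s t : ℝ), s • T₁ x + t • T₂ x = 0 → s = 0 ∧ t = 0)
    (hs₁ : SmoothEnd E S₀ T₁ univ) (hs₂ : SmoothEnd E S₀ T₂ univ) :
    𝒬.Q.ReducesAlong (SmoothSpin E h) (spinInclusion h α) := by
  have hloc : ∀ x₀ : M, ∃ (O : Set M) (σ : ∀ x, 𝒬.Q.Fib x), IsOpen O ∧ x₀ ∈ O ∧
      𝒬.Q.IsSmoothSection O σ ∧ ∀ y ∈ O, u.IsAdapted T₁ T₂ y (σ y) := by
    intro x₀
    obtain ⟨t, ht, hxt⟩ := 𝒬.Q.cover x₀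
    obtain ⟨O, β, hO, hxO, hOt, hβ, had⟩ :=
      exists_local_adapted (u := u) hα hd hT₁ hT₂ hli hs₁ hs₂ ht hxt
    exact ⟨O, _, hO, hxO, IsSmoothSection.act (IsSmoothSection.mono
      (isSmoothSection_of_mem_atlas ht) hOt) (SmoothSpinO.mk (smoothVec_const _) hβ), had⟩
  have hne : ∀ x, ∃ z, u.IsAdapted T₁ T₂ x z := fun x => by
    obtain ⟨O, σ, -, hxO, -, had⟩ := hloc x
    exact ⟨σ x, had x hxO⟩
  choose z₀ hz₀ using hne
  let P' : PrincipalBundle.{u, _, w} M (Spin h) (SmoothSpin E h) :=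
    { Fib := fun x => {z : 𝒬.Q.Fib x // u.IsAdapted T₁ T₂ x z}
      act := fun q a => ⟨𝒬.Q.act q.1 (spinInclusion h α a), IsAdapted.act hd q.2 a⟩
      act_one := fun q => Subtype.ext (by
        change 𝒬.Q.act q.1 (spinInclusion h α 1) = q.1
        rw [map_one, 𝒬.Q.act_one])
      act_mul := fun q a b => Subtype.ext (by
        change 𝒬.Q.act q.1 (spinInclusion h α (a * b)) =
          𝒬.Q.act (𝒬.Q.act q.1 (spinInclusion h α a)) (spinInclusion h α b)
        rw [map_mul, 𝒬.Q.act_mul])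
      existsUnique_act := fun q q' => by
        obtain ⟨a, ha⟩ := IsAdapted.exists_act_eq hα hneg hd q.2 q'.2
        refine ⟨a, Subtype.ext ha, fun b hb => spinInclusion_injective (α := α) ?_⟩
        exact (𝒬.Q.existsUnique_act q.1 q'.1).unique (congrArg Subtype.val hb) ha
      -- All adapted sections smooth in `Q` are admitted. Transitions are smooth into `Spinᵒ`, take
      -- values in `Spin`, and hence are smooth there.
      atlas := {s | IsOpen s.1 ∧ 𝒬.Q.IsSmoothSection s.1 (fun x => (s.2 x).1)}
      isOpen_atlas := fun s hs => hs.1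
      cover := fun x₀ => by
        classical
        obtain ⟨O, σ, hO, hxO, hσ, had⟩ := hloc x₀
        -- Atlas sections are total functions, so off `O` an arbitrary adapted point `z₀ x` fills
        -- in.
        refine ⟨(O, fun x => if hx : x ∈ O then ⟨σ x, had x hx⟩ else ⟨z₀ x, hz₀ x⟩),
          ⟨hO, fun t ht => ?_⟩, hxO⟩
        obtain ⟨f, hf, hsm⟩ := hσ t ht
        exact ⟨f, fun x hx => by simp only [dif_pos hx.1]; exact hf x hx, hsm⟩
      smooth_transition := fun s hs t ht => by
        choose f hf using fun x => IsAdapted.exists_act_eq hα hneg hd (s.2 x).2 (t.2 x).2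
        exact ⟨f, fun x _ => Subtype.ext (hf x).symm, SmoothSpinO.smoothSpin
          (IsSmoothSection.transition hs.2 ht.2 fun x _ => (hf x).symm)⟩ }
  exact ⟨P', fun x q => q.1, fun x q a => rfl, fun s hs => hs.2⟩

theorem AssociatedIso.reducesAlong_of_isTrivialBundle [FiniteDimensional ℝ V]
    [FiniteDimensional ℝ S₀] [Nonempty M] (u : AssociatedIso 𝒬 𝒮 γ₀ γ₂) (hα : α = 1 ∨ α = -1)
    (hneg : (-1 : (CliffordAlgebra h)ˣ) ∈ Spin h) (hd : TwistData γ₀ γ₂)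
    (hA : IsTrivialBundle E S₀ (anticommutantBundle 𝒮)) :
    𝒬.Q.ReducesAlong (SmoothSpin E h) (spinInclusion h α) := by
  obtain ⟨n, ψ, hψ⟩ := hA
  obtain ⟨σ⟩ := 𝒬.Q.nonempty_sections
  -- The rank is read off at one point, where a point of `Q` identifies the fibre of `A` with `ℝ²`.
  have hn : n = 2 := by
    have x : M := Classical.arbitrary M
    simpa using ((ψ x).trans (u.anticommutantEquiv hd x (σ x)).symm).finrank_eq
  subst hn
  refine reducesAlong_of_frame u hα hneg hd (fun x => (ψ x (Pi.single 0 1)).2)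
    (fun x => (ψ x (Pi.single 1 1)).2) (fun x s t hst => ?_) (hψ _) (hψ _)
  rw [← Submodule.coe_smul, ← Submodule.coe_smul, ← Submodule.coe_add, ← map_smul, ← map_smul,
    ← map_add, Submodule.coe_eq_zero, LinearEquiv.map_eq_zero_iff] at hst
  exact ⟨by simpa using congrFun hst 0, by simpa using congrFun hst 1⟩

end Reduction

theorem alphaSign_eq (p q : ℕ) : alphaSign p q = 1 ∨ alphaSign p q = -1 := by
  unfold alphaSign
  split_ifs
  exacts [Or.inr rfl, Or.inl rfl]

end SpinO

end

theorem mainTheorem7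
    {E : Type*} [NormedAddCommGroup E] [NormedSpace ℝ E] [FiniteDimensional ℝ E]
    {M : Type*} [TopologicalSpace M] [T2Space M] [ParacompactSpace M] [ConnectedSpace M]
    [ChartedSpace E M] [IsManifold 𝓘(ℝ, E) ∞ M]
    (p q : ℕ) (hpq : (p : ℤ) - q ≡ 3 [ZMOD 8] ∨ (p : ℤ) - q ≡ 7 [ZMOD 8])
    (g : SpinO.PseudoRiemannianMetric E M p q)
    {V : Type*} [AddCommGroup V] [Module ℝ V] [FiniteDimensional ℝ V]
    (h : QuadraticForm ℝ V) (hh : SpinO.HasSignature h p q)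
    {S₀ : Type*} [NormedAddCommGroup S₀] [NormedSpace ℝ S₀] [FiniteDimensional ℝ S₀]
    (γ₀ : CliffordAlgebra h →ₐ[ℝ] (S₀ →L[ℝ] S₀)) (hγ₀ : SpinO.IsElementary γ₀)
    (γ₂ : CliffordAlgebra (SpinO.planeForm (SpinO.alphaSign p q)) →ₐ[ℝ] (S₀ →L[ℝ] S₀))
    (hγ₂ : SpinO.IsCompatible h (SpinO.alphaSign p q) γ₀ γ₂)
    {S : M → Type*} [TopologicalSpace (TotalSpace S₀ S)]
    [∀ x, AddCommGroup (S x)] [∀ x, Module ℝ (S x)] [∀ x, TopologicalSpace (S x)]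
    [∀ x, IsTopologicalAddGroup (S x)] [∀ x, ContinuousSMul ℝ (S x)]
    [FiberBundle S₀ S] [VectorBundle ℝ S₀ S] [ContMDiffVectorBundle ∞ S₀ S 𝓘(ℝ, E)]
    (𝒮 : SpinO.ElementaryPinor S₀ S g)
    (𝒬 : SpinO.SpinOStructure g h (SpinO.alphaSign p q))
    (u : SpinO.AssociatedIso 𝒬 𝒮 γ₀ γ₂) :
    (SpinO.IsTrivialBundle E S₀ (SpinO.anticommutantBundle 𝒮) ↔
      𝒬.Q.ReducesAlong (SpinO.SmoothSpin E h)
        (SpinO.spinInclusion h (SpinO.alphaSign p q))) ∧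
    (SpinO.IsTrivialBundle E S₀ (SpinO.anticommutantBundle 𝒮) →
      SpinO.IsOrientable E M ∧
      SpinO.IsTrivialAlgBundle E S₀ ℂ (SpinO.schurBundle 𝒮) ∧
      SpinO.IsTrivialAlgBundle E S₀
        (CliffordAlgebra (SpinO.planeForm (SpinO.alphaSign p q))) (SpinO.twistBundle 𝒮)) := by
  have hα := SpinO.alphaSign_eq p q
  -- `p + q` and `p - q` have the same parity, and `p - q` is odd.
  have hodd : Odd (Module.finrank ℝ V) := by
    rw [hh.2.2, Nat.odd_iff]
    simp only [Int.ModEq] at hpq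
    omega
  have hd := hγ₂.twistData hα hodd hγ₀
  -- An anisotropic vector is found in the orthonormal basis behind the volume element, nonempty
  -- because the dimension is odd.
  have hneg : (-1 : (CliffordAlgebra h)ˣ) ∈ SpinO.Spin h := by
    obtain ⟨-, -, ⟨e, he, -, -⟩, -⟩ := hγ₂
    refine SpinO.neg_one_mem_Spin h (e ⟨0, hodd.pos⟩) ?_
    rcases he ⟨0, hodd.pos⟩ with h' | h' <;> rw [h'] <;> norm_num
  refine ⟨⟨u.reducesAlong_of_isTrivialBundle hα hneg hd,
    u.isTrivialBundle_anticommutantBundle hd⟩, fun hA => ?_⟩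
  have hr := u.reducesAlong_of_isTrivialBundle hα hneg hd hA
  exact ⟨𝒬.isOrientable hodd hr, u.isTrivialAlgBundle_schurBundle hα hd hr,
    u.isTrivialAlgBundle_twistBundle hd hr⟩
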